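/- **Setting.** Let $\mathcal X\subseteq[0,r]^d$, let $\kappa$ be a measurable positive semidefinite kernel on $\mathcal X$ with $\sup_x\kappa(x,x)<\infty$, and let $\mathcal H_\kappa$ be its reproducing kernel Hilbert space with norm $\|\cdot\|_\kappa$. Let $\eta\ge\frac12$. For $n\ge 0$ let $$\Phi_n(\mathcal X)=\sup_{x_1,\dots,x_n\in\mathcal X} I(f_A+\varepsilon_A;f_A)$$ be the maximum information gain of $n$ evaluations (points may be repeated), where $f_A\sim\mathcal N(0,(\kappa(x_i,x_j))_{i,j})$ and $\varepsilon_A\sim\mathcal N(0,\eta^2I)$ are independent and $I(X;Y)=H(X)-H(X\mid Y)$ is the mutual information. The target is a function $f\in\mathcal H_\kappa$ with $\|f\|_\kappa\le B$. A comparison of $x$ with $x'$ is won by $x$ with probability $p(x,x')=\Pr[x\succ x']\in[0,1]$, where $p$ is measurable. Let $\rho$ be the probability distribution on $\mathcal X$ from which random points are drawn, and let $f_r(x)=\int p(x,x')\,\rho(dx')$ be the Borda function. Assume $f_r\in\mathcal H_\kappa$ with $\|f_r\|_\kappa\le B$. Comparisons are unbiased, that is, the comparison function is $f_c=f$, and there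 are constants $L_1,L_2>0$ such that for all $x\in\mathcal X$ $$\tfrac1{L_1}\bigl(f_c^*-f_c(x)\bigr)\le f_r^*-f_r(x)\le L_2\bigl(f_c^*-f_c(x)\bigr),$$ where $g^*=\sup_{\mathcal X} g$. A comparison costs $\lambda_c>0$, a direct query of $f$ (with centered noise in $[-\eta,\eta]$) costs $\lambda_l>\lambda_c$, the budget is $\Lambda\ge\lambda_c$, and $\bar n_\Lambda=\lceil\Lambda/\lambda_c\rceil$. **Algorithm.** COMP-GP-UCB has inputs $\zeta,\gamma\ge0$, $\delta\in(0,1)$ and multipliers $\beta^{(r)}_t,\beta_t$. For $k\in\{r,l\}$, $\mu^{(k)}_t(x)=k_x^\top(K+\eta^2I)^{-1}Y$ and $\sigma^{(k)}_t(x)^2=\kappa(x,x)-k_x^\top(K+\eta^2I)^{-1}k_x$ are computed from the comparisons ($k=r$) or direct queries ($k=l$) of rounds $1,\dots,t$, where $K$ is the kernel matrix of the queried points $x_i$, $k_x=(\kappa(x,x_i))_i$, and $Y$ is the vector of feedbacks. A comparison at $x_t$ draws $x_t'\sim\rho$ afresh and returns feedback $1$ with probability $p(x_t,x'_t)$ and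 $0$ otherwise. *Phase 1:* in round $t$, compare at a maximizer $x_t$ of $\mu^{(r)}_{t-1}+\beta^{(r)}_t\sigma^{(r)}_{t-1}$ over $\mathcal X$, until after some round $T$ one has $\beta^{(r)}_T\sigma^{(r)}_{T-1}(x_T)\le\gamma$. Put $\hat f_r=\mu^{(r)}_{T-1}(x_T)-\beta^{(r)}_T\sigma^{(r)}_{T-1}(x_T)$. *Phase 2:* in round $t>T$, let $x_t$ maximize $\mu^{(l)}_{t-1}+\beta_t\sigma^{(l)}_{t-1}$ over the $x\in\mathcal X$ with $\mu^{(r)}_{t-1}(x)+\beta^{(r)}_t\sigma^{(r)}_{t-1}(x)-\hat f_r+L_2\zeta\ge0$; make a comparison at $x_t$ if $\beta^{(r)}_t\sigma^{(r)}_{t-1}(x_t)\ge\gamma$ and a direct query at $x_t$ otherwise. The run goes on as long as its total cost is at most $\Lambda$. Its simple regret $S(\Lambda)$ is the minimum, over the rounds $t$ carried out, of $f^*-f(x_t)$ for a direct query and of $\min\{f^*-f(x_t),f^*-f(x_t')\}$ for a comparison. **Theorem.** There is a constant $C>0$ that depends only on $d$, $\mathcal X$, $\kappa$, $\eta$ and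 $L_1$ (not on $B,\delta,f,p,\rho,L_2,\beta_t$, the costs or $\Lambda$) such that the following holds. Run COMP-GP-UCB with $\zeta=\gamma=0$ and $$\beta^{(r)}_t=2B+\sqrt{2\bigl(\Phi_{t-1}(\mathcal X)+1+\log(1/\delta)\bigr)},$$ with arbitrary $\beta_t$ and any (history-dependent, possibly randomized) choice among maximizers. Then only comparisons are made, and with probability at least $1-\delta$ $$S(\Lambda)\le C\Bigl(B+\sqrt{\Phi_{\bar n_\Lambda}(\mathcal X)+\log(1/\delta)}\Bigr)\sqrt{\frac{\Phi_{\bar n_\Lambda}(\mathcal X)}{\bar n_\Lambda}}.$$ -/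

import Mathlib

open MeasureTheory ProbabilityTheory
open scoped Matrix

namespace DuelingChoice

/-! ### Entropy, mutual information and the maximum information gain -/

section Information

/-- Differential entropy `H(μ) = -∫ log (dμ/dx) dμ` of a law `μ` with a Lebesgue density. -/
noncomputable def diffEntropy {E : Type*} [MeasureSpace E] (μ : Measure E) : ℝ :=
  -∫ x, Real.log (μ.rnDeriv volume x).toReal ∂μ

/-- Conditional differential entropy `H(X | Y)`: the entropy of the regular conditional
distribution of `X` given `Y = y`, averaged over the law of `Y`. -/
noncomputable def condDiffEntropy {Ω E F : Type*} [MeasurableSpace Ω] [MeasureSpace E]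
    [StandardBorelSpace E] [Nonempty E] [MeasurableSpace F]
    (X : Ω → E) (Y : Ω → F) (P : Measure Ω) [IsFiniteMeasure P] : ℝ :=
  ∫ y, diffEntropy (condDistrib X Y P y) ∂(P.map Y)

/-- Mutual information `I(X; Y) = H(X) - H(X | Y)`. -/
noncomputable def mutualInfo {Ω E F : Type*} [MeasurableSpace Ω] [MeasureSpace E]
    [StandardBorelSpace E] [Nonempty E] [MeasurableSpace F]
    (X : Ω → E) (Y : Ω → F) (P : Measure Ω) [IsFiniteMeasure P] : ℝ :=
  diffEntropy (P.map X) - condDiffEntropy X Y P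

/-- The information gain `I(f_A + ε_A; f_A)` of the evaluations at `x 0, …, x (n - 1)`:
`f_A ∼ N(0, K)` with `K i j = κ (x i) (x j)`, and independently `ε_A ∼ N(0, η² I)`. -/
noncomputable def infoGain {X : Type*} (κ : X → X → ℝ) (η : ℝ) {n : ℕ} (x : Fin n → X) : ℝ :=
  mutualInfo
    (fun q : EuclideanSpace ℝ (Fin n) × EuclideanSpace ℝ (Fin n) => q.1 + q.2)
    (fun q : EuclideanSpace ℝ (Fin n) × EuclideanSpace ℝ (Fin n) => q.1)
    ((multivariateGaussian 0 (Matrix.of fun i j => κ (x i) (x j))).prod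
      (multivariateGaussian 0 (η ^ 2 • (1 : Matrix (Fin n) (Fin n) ℝ))))

/-- The maximum information gain `Φ_n(X)` of `n` evaluations on `X`. -/
noncomputable def maxInfoGain {X : Type*} (κ : X → X → ℝ) (η : ℝ) (n : ℕ) : ℝ :=
  ⨆ x : Fin n → X, infoGain κ η x

end Information

/-! ### Gaussian process posterior -/

section Posterior

variable {X : Type*} (κ : X → X → ℝ) (η : ℝ)

/-- `K + η² I` for the observations with indices in `s`. -/
noncomputable def regGram (s : Finset ℕ) (xs : ℕ → X) : Matrix s s ℝ :=
  Matrix.of (fun i j : s => κ (xs i) (xs j)) + η ^ 2 • (1 : Matrix s s ℝ)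

/-- The vector `k = (κ(x, x_i))_i` for the observations with indices in `s`. -/
def crossVec (s : Finset ℕ) (xs : ℕ → X) (x : X) : s → ℝ := fun i => κ x (xs i)

/-- Posterior mean `kᵀ (K + η² I)⁻¹ Y` at `x`. -/
noncomputable def postMean (s : Finset ℕ) (xs : ℕ → X) (ys : ℕ → ℝ) (x : X) : ℝ :=
  crossVec κ s xs x ⬝ᵥ ((regGram κ η s xs)⁻¹ *ᵥ fun i : s => ys i)

/-- Posterior variance `κ(x, x) - kᵀ (K + η² I)⁻¹ k` at `x`. -/
noncomputable def postVar (s : Finset ℕ) (xs : ℕ → X) (x : X) : ℝ :=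
  κ x x - crossVec κ s xs x ⬝ᵥ ((regGram κ η s xs)⁻¹ *ᵥ crossVec κ s xs x)

/-- Posterior standard deviation at `x`. -/
noncomputable def postSD (s : Finset ℕ) (xs : ℕ → X) (x : X) : ℝ :=
  Real.sqrt (postVar κ η s xs x)

end Posterior

/-! ### The algorithm COMP-GP-UCB -/

/-- The two kinds of queries: comparisons and direct queries. -/
inductive QueryType where
  | comp
  | label
  deriving DecidableEq

/-- The record of a run. Rounds are numbered from `0`. In round `t` the point `x t` is queried
with query type `q t`, and `y t` is the feedback; `x' t` is the random point with which `x t`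
is compared (of no significance if `q t = label`). -/
structure Trajectory (X : Type*) where
  x : ℕ → X
  x' : ℕ → X
  q : ℕ → QueryType
  y : ℕ → ℝ

/-- The inputs of COMP-GP-UCB: kernel `κ`, regularization `η`, confidence multipliers `betaR`
(for the Borda function) and `beta` (for the target function), constant `L₂`, comparison bias `ζ`
and threshold `γ`. The multipliers `betaR t`, `beta t` are the ones used in round `t`, counted from
`0`, that is, after `t` queries. -/
structure Params (X : Type*) where
  κ : X → X → ℝ
  η : ℝ
  betaR : ℕ → ℝ
  beta : ℕ → ℝ
  L₂ : ℝ
  ζ : ℝ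
  γ : ℝ

namespace Trajectory

variable {X : Type*} (par : Params X) (τ : Trajectory X)

/-- The rounds before round `t` with a query of type `k`. -/
def before (k : QueryType) (t : ℕ) : Finset ℕ := {s ∈ Finset.range t | τ.q s = k}

/-- Posterior mean at the start of round `t`, from the earlier queries of type `k`. -/
noncomputable def mean (k : QueryType) (t : ℕ) (x : X) : ℝ :=
  postMean par.κ par.η (τ.before k t) τ.x τ.y x

/-- Posterior standard deviation at the start of round `t`, from the earlier queries of
type `k`. -/
noncomputable def sd (k : QueryType) (t : ℕ) (x : X) : ℝ :=
  postSD par.κ par.η (τ.before k t) τ.x x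

/-- Upper confidence bound for the Borda function in round `t`. -/
noncomputable def ucbR (t : ℕ) (x : X) : ℝ :=
  τ.mean par .comp t x + par.betaR t * τ.sd par .comp t x

/-- Upper confidence bound for the target function in round `t`. -/
noncomputable def ucbL (t : ℕ) (x : X) : ℝ :=
  τ.mean par .label t x + par.beta t * τ.sd par .label t x

/-- The condition that ends the first phase after round `t`. -/
def Stops (t : ℕ) : Prop := par.betaR t * τ.sd par .comp t (τ.x t) ≤ par.γ

/-- The lower bound on the maximum of the Borda function obtained in the last round `T` of the
first phase. -/
noncomputable def lcb (T : ℕ) : ℝ :=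
  τ.mean par .comp T (τ.x T) - par.betaR T * τ.sd par .comp T (τ.x T)

/-- The filter of the second phase, when the first phase has ended with round `T`. -/
noncomputable def filter (T t : ℕ) (x : X) : ℝ :=
  τ.ucbR par t x - τ.lcb par T + par.L₂ * par.ζ

/-- The queries of the run are the ones that COMP-GP-UCB makes (ties between maximizers are broken
arbitrarily, and the run is continued indefinitely; a budget cuts it off). -/
structure IsCompGPUCB : Prop where
  /-- First phase: as long as the stopping condition has not been met, compare a maximizer of the
  upper confidence bound for the Borda function. -/
  phase1 : ∀ t, (∀ s < t, ¬ τ.Stops par s) →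
    τ.q t = .comp ∧ ∀ x, τ.ucbR par t x ≤ τ.ucbR par t (τ.x t)
  /-- Second phase, after the stopping condition has been met for the first time in round `T`. -/
  phase2 : ∀ T t, T < t → (∀ s < T, ¬ τ.Stops par s) → τ.Stops par T →
    0 ≤ τ.filter par T t (τ.x t) ∧
    (∀ x, 0 ≤ τ.filter par T t x → τ.ucbL par t x ≤ τ.ucbL par t (τ.x t)) ∧
    (τ.q t = .comp ↔ par.γ ≤ par.betaR t * τ.sd par .comp t (τ.x t))

/-- Cost of the query of round `t`. -/
def cost (lamL lamC : ℝ) (t : ℕ) : ℝ :=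
  match τ.q t with
  | .comp => lamC
  | .label => lamL

/-- The rounds that are carried out under the budget `Lam`. -/
def roundsWithin (lamL lamC Lam : ℝ) : Set ℕ :=
  {t | ∑ s ∈ Finset.range (t + 1), τ.cost lamL lamC s ≤ Lam}

/-- Regret of round `t`: the gap of the queried point for direct queries, the smaller of the two
gaps for comparisons. -/
noncomputable def roundRegret (f : X → ℝ) (t : ℕ) : ℝ :=
  match τ.q t with
  | .comp => min ((⨆ z, f z) - f (τ.x t)) ((⨆ z, f z) - f (τ.x' t))
  | .label => (⨆ z, f z) - f (τ.x t)

/-- Simple regret `S(Λ)` under the budget `Lam`. -/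
noncomputable def simpleRegret (f : X → ℝ) (lamL lamC Lam : ℝ) : ℝ :=
  sInf (τ.roundRegret f '' τ.roundsWithin lamL lamC Lam)

end Trajectory

/-! ### The feedback model -/

/-- The Borda function `f_r(x) = Pr[x ≻ X]`, `X ∼ ρ`, where `p x x' = Pr[x ≻ x']`. -/
noncomputable def borda {X : Type*} [MeasurableSpace X] (p : X → X → ℝ) (ρ : Measure X) (x : X) :
    ℝ :=
  ∫ x', p x x' ∂ρ

/-- The Borda function `fr` is sandwiched by the comparison function `fc` at the optimum. -/
def BordaSandwich {X : Type*} (L₁ L₂ : ℝ) (fc fr : X → ℝ) : Prop :=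
  ∀ x, 1 / L₁ * ((⨆ z, fc z) - fc x) ≤ (⨆ z, fr z) - fr x ∧
    (⨆ z, fr z) - fr x ≤ L₂ * ((⨆ z, fc z) - fc x)

/-- The law of the feedback. `ℱ t` is the information available when the query of round `t` is
chosen. The random point `x' t` is drawn from `ρ`, independently of `ℱ t`. Given `ℱ t` and `x' t`,
a comparison is won (`y t = 1`) with probability `p (x t) (x' t)` and lost (`y t = 0`) otherwise; a
direct query returns `f (x t)` plus a centered noise with values in `[-η, η]`. -/
structure IsFeedbackProcess {Ω X : Type*} {m : MeasurableSpace Ω} [MeasurableSpace X]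
    (p : X → X → ℝ) (ρ : Measure X) (f : X → ℝ) (η : ℝ) (P : Measure Ω) (ℱ : Filtration ℕ m)
    (τ : Ω → Trajectory X) : Prop where
  measurable_x : ∀ t, Measurable[ℱ t] fun ω => (τ ω).x t
  measurable_q : ∀ t, MeasurableSet[ℱ t] {ω | (τ ω).q t = .comp}
  measurable_x' : ∀ t, Measurable[ℱ (t + 1)] fun ω => (τ ω).x' t
  measurable_y : ∀ t, Measurable[ℱ (t + 1)] fun ω => (τ ω).y t
  map_x' : ∀ t, P.map (fun ω => (τ ω).x' t) = ρ
  indep_x' : ∀ t, Indep (MeasurableSpace.comap (fun ω => (τ ω).x' t) inferInstance) (ℱ t) P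
  comp_range : ∀ t, ∀ᵐ ω ∂P, (τ ω).q t = .comp → (τ ω).y t = 0 ∨ (τ ω).y t = 1
  label_range : ∀ t, ∀ᵐ ω ∂P, (τ ω).q t = .label → |(τ ω).y t - f ((τ ω).x t)| ≤ η
  condExp_y : ∀ t,
    P[fun ω => (τ ω).y t |
        ℱ t ⊔ MeasurableSpace.comap (fun ω => (τ ω).x' t) inferInstance] =ᵐ[P]
      fun ω =>
        match (τ ω).q t with
        | .comp => p ((τ ω).x t) ((τ ω).x' t)
        | .label => f ((τ ω).x t)

/-- The reproducing kernel `κ` of a Hilbert space of real functions on `X`. -/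
noncomputable def rkhsKernel {X : Type*} (H : Type*) [NormedAddCommGroup H] [InnerProductSpace ℝ H]
    [CompleteSpace H] [RKHS ℝ H X ℝ] (x y : X) : ℝ :=
  RKHS.kernel H x y 1

end DuelingChoice

/-! With `γ = 0` and nonnegative multipliers, both phases can only compare, so the run is UCB on the
Borda function `f_r` until its first stop. A stop requires width `β σ ≤ 0` at the queried point, and
a UCB maximizer has gap at most twice its width. So on the event that the confidence bounds hold, a
stopping round has already hit a Borda maximizer. If there is no stop, some gap is at most the
average of the doubled widths over the affordable rounds. The lower half of the sandwich turns a
Borda gap into a gap of `f` at cost `L₁`.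

The confidence bounds come from a method of mixtures. Let `A = η² (η² + ∑ φ_j ⊗ φ_j)⁻¹` act on the
RKHS, and let `S` be the noise-weighted sum of features. The error of the posterior mean at `x` is
`⟪S, A φ(x)⟫ / η² - ⟪f_r, A φ(x)⟫`, and Cauchy–Schwarz for the form of `A` bounds it by `(‖f_r‖ +
√⟪S, A S⟫ / η²) σ(x)` (`abs_postMean_sub_le`). Given the past, a comparison is Bernoulli with mean
`f_r(x_t)` (`integral_mul_feedback`), hence `1/4`-sub-Gaussian, and `η² ≥ 1/4`. This makes `exp(⟪S,
A S⟫ / (2 η⁴)) / √det(1 + K / η²)` a supermartingale (`exp_increment_le`, `potential_step`). Ville's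
inequality keeps it below `1 / δ` at all relevant times at once.

The information gain equals `½ log det(1 + K / η²)` (`mutualInfo_gaussian`), whose pivots are the
successive posterior variances (`det_ridgeGram`). So `Φ` controls both the multiplier and the sum of
squared widths (`sum_postCov_le`), and Cauchy–Schwarz over the rounds gives the rate. -/

namespace DuelingChoice

/-! ### Lebesgue density of the standard Gaussian and affine change of variables -/

section GaussianEntropy

variable {E : Type*} [NormedAddCommGroup E] [InnerProductSpace ℝ E]

variable (E) in
/-- The Lebesgue density of the standard Gaussian measure. -/
noncomputable def stdGaussianDensity (x : E) : ℝ :=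
  ((2 * Real.pi) ^ ((Module.finrank ℝ E : ℝ) / 2))⁻¹ * Real.exp (-(1 / 2) * ‖x‖ ^ 2)

lemma stdGaussianDensity_pos (x : E) : 0 < stdGaussianDensity E x := by
  unfold stdGaussianDensity; positivity

variable [MeasurableSpace E] [BorelSpace E]

@[fun_prop]
lemma measurable_stdGaussianDensity : Measurable (stdGaussianDensity E) := by
  unfold stdGaussianDensity; fun_prop

variable [FiniteDimensional ℝ E]

lemma integrable_stdGaussianDensity : Integrable (stdGaussianDensity E) := by
  unfold stdGaussianDensity
  refine Integrable.const_mul ?_ _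
  have h := (GaussianFourier.integrable_cexp_neg_mul_sq_norm_add (V := E) (b := 1 / 2)
    (by norm_num) 0 0).re
  refine h.congr (ae_of_all _ fun x => ?_)
  have : (-(1 / 2 : ℂ) * (‖x‖ : ℂ) ^ 2 + 0 * ((inner ℝ (0 : E) x : ℝ) : ℂ))
      = ((-(1 / 2) * ‖x‖ ^ 2 : ℝ) : ℂ) := by push_cast; ring
  simp only [this, ← Complex.ofReal_exp]
  exact Complex.ofReal_re _

/-- Finite measures are determined by their characteristic functions, and that of the density is the
Gaussian Fourier integral. -/
theorem stdGaussian_eq_withDensity :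
    stdGaussian E = volume.withDensity fun x => ENNReal.ofReal (stdGaussianDensity E x) := by
  have : IsFiniteMeasure (volume.withDensity fun x => ENNReal.ofReal (stdGaussianDensity E x)) :=
    isFiniteMeasure_withDensity_ofReal integrable_stdGaussianDensity.2
  apply Measure.ext_of_charFun
  ext t
  rw [charFun_stdGaussian, charFun_apply, integral_withDensity_eq_integral_toReal_smul
    (by fun_prop) (by simp)]
  have h := GaussianFourier.integral_cexp_neg_mul_sq_norm_add (V := E) (b := 1 / 2)
    (by norm_num) Complex.I t
  have hc : ((Real.pi : ℂ) / (1 / 2)) ^ ((Module.finrank ℝ E : ℂ) / 2)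
      = (((2 * Real.pi) ^ ((Module.finrank ℝ E : ℝ) / 2) : ℝ) : ℂ) := by
    rw [Complex.ofReal_cpow (by positivity)]
    push_cast
    congr 1
    ring
  set k : ℝ := (2 * Real.pi) ^ ((Module.finrank ℝ E : ℝ) / 2) with hk
  have hk0 : (k : ℂ) ≠ 0 := by
    rw [Complex.ofReal_ne_zero]; positivity
  rw [hc] at h
  have h2 : ∀ x : E, (ENNReal.ofReal (stdGaussianDensity E x)).toReal •
      Complex.exp (((inner ℝ x t : ℝ) : ℂ) * Complex.I) =
      (k : ℂ)⁻¹ * Complex.exp (-(1 / 2) * (‖x‖ : ℂ) ^ 2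
        + Complex.I * ((inner ℝ t x : ℝ) : ℂ)) := by
    intro x
    rw [ENNReal.toReal_ofReal (stdGaussianDensity_pos x).le, stdGaussianDensity, Complex.exp_add,
      real_inner_comm, Complex.real_smul]
    push_cast
    rw [mul_comm Complex.I, mul_assoc]
  simp_rw [h2]
  rw [integral_const_mul, h, ← mul_assoc, inv_mul_cancel₀ hk0, one_mul]
  congr 1
  rw [Complex.I_sq]
  ring

lemma integrable_log_stdGaussianDensity :
    Integrable (fun x => Real.log (stdGaussianDensity E x)) (stdGaussian E) := by
  have h : ∀ x : E, Real.log (stdGaussianDensity E x) =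
      Real.log ((2 * Real.pi) ^ ((Module.finrank ℝ E : ℝ) / 2))⁻¹ + -(1 / 2) * ‖x‖ ^ 2 := by
    intro x
    rw [stdGaussianDensity, Real.log_mul (by positivity) (by positivity), Real.log_exp]
  simp_rw [h]
  refine (integrable_const _).add (Integrable.const_mul ?_ _)
  exact (IsGaussian.memLp_two_id (μ := stdGaussian E)).integrable_norm_pow (by norm_num)

/-- The inverse is exposed only through `S (v + A x) = x`: this is all that is needed to evaluate
the image density along the map. -/
theorem map_affine_withDensity (v : E) (A : E →L[ℝ] E)
    (hA : LinearMap.det (A : E →ₗ[ℝ] E) ≠ 0) {g : E → ENNReal} (hg : Measurable g) :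
    ∃ S : E → E, Measurable S ∧ (∀ x, S (v + A x) = x) ∧
      (volume.withDensity g).map (fun x => v + A x) = volume.withDensity
        fun z => ENNReal.ofReal |(LinearMap.det (A : E →ₗ[ℝ] E))⁻¹| * g (S z) := by
  let e := LinearMap.equivOfDetNeZero (A : E →ₗ[ℝ] E) hA
  have he : ∀ x, e x = A x := fun x => rfl
  have hem : Measurable e.symm :=
    (LinearMap.continuous_of_finiteDimensional (e.symm : E →ₗ[ℝ] E)).measurable
  refine ⟨fun z => e.symm (z - v), by fun_prop, fun x => ?_, ?_⟩
  · simp [← he]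
  have hT : Measurable fun x => v + A x := by fun_prop
  have hvol : (volume : Measure E).map (fun x => v + A x)
      = ENNReal.ofReal |(LinearMap.det (A : E →ₗ[ℝ] E))⁻¹| • volume := by
    have h1 := Measure.map_linearMap_addHaar_eq_smul_addHaar (volume : Measure E) hA
    have h2 : (fun x => v + A x) = (fun x => v + x) ∘ (A : E →ₗ[ℝ] E) := rfl
    rw [h2, ← Measure.map_map (by fun_prop) (by exact A.measurable), h1, Measure.map_smul,
      map_add_left_eq_self]
  have hgS : Measurable fun z => g (e.symm (z - v)) := by fun_prop
  change _ = volume.withDensity (ENNReal.ofReal |(LinearMap.det (A : E →ₗ[ℝ] E))⁻¹| •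
    fun z => g (e.symm (z - v)))
  rw [withDensity_smul _ hgS, ← withDensity_smul_measure, ← hvol]
  ext s hs
  rw [Measure.map_apply hT hs, withDensity_apply _ (hT hs), withDensity_apply _ hs,
    setLIntegral_map hs hgS hT]
  simp [← he]

end GaussianEntropy

/-! ### Entropy and mutual information of Gaussian vectors -/

section GaussianInformation

open scoped MatrixOrder

variable {ι : Type*} [Fintype ι]

theorem diffEntropy_map_affine_stdGaussian (v : EuclideanSpace ℝ ι)
    (A : EuclideanSpace ℝ ι →L[ℝ] EuclideanSpace ℝ ι)
    (hA : LinearMap.det (A : EuclideanSpace ℝ ι →ₗ[ℝ] EuclideanSpace ℝ ι) ≠ 0) :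
    diffEntropy ((stdGaussian (EuclideanSpace ℝ ι)).map fun x => v + A x) =
      Real.log |LinearMap.det (A : EuclideanSpace ℝ ι →ₗ[ℝ] EuclideanSpace ℝ ι)|
        - ∫ x, Real.log (stdGaussianDensity _ x) ∂(stdGaussian (EuclideanSpace ℝ ι)) := by
  obtain ⟨S, hS, hSA, hmap⟩ := map_affine_withDensity v A hA
    (g := fun x => ENNReal.ofReal (stdGaussianDensity _ x)) (by fun_prop)
  rw [← stdGaussian_eq_withDensity] at hmap
  set D := LinearMap.det (A : EuclideanSpace ℝ ι →ₗ[ℝ] EuclideanSpace ℝ ι)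
  have hD : |D| ≠ 0 := abs_ne_zero.2 hA
  set h : EuclideanSpace ℝ ι → ENNReal :=
    fun z => ENNReal.ofReal |D⁻¹| * ENNReal.ofReal (stdGaussianDensity _ (S z)) with hh
  have hhm : Measurable h := by fun_prop
  set ν := (stdGaussian (EuclideanSpace ℝ ι)).map fun x => v + A x with hν
  have hac : ν ≪ volume := hmap ▸ withDensity_absolutelyContinuous _ _
  -- The density is identified only up to Lebesgue null sets; absolute continuity makes these null
  -- for `ν`, over which the entropy integrates.
  have hrn : ν.rnDeriv volume =ᵐ[ν] h := by
    refine hac.ae_eq ?_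
    rw [hmap]
    exact Measure.rnDeriv_withDensity _ hhm
  rw [diffEntropy, integral_congr_ae (g := fun z => Real.log (h z).toReal)
    (hrn.mono fun z hz => by simp only [hz]), hν, integral_map (by fun_prop)
    (by exact (by fun_prop : Measurable _).aestronglyMeasurable)]
  have hlog : ∀ x, Real.log (h (v + A x)).toReal =
      -Real.log |D| + Real.log (stdGaussianDensity _ x) := by
    intro x
    rw [hh]
    simp only [hSA]
    rw [ENNReal.toReal_mul, ENNReal.toReal_ofReal (abs_nonneg _),
      ENNReal.toReal_ofReal (stdGaussianDensity_pos x).le,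
      Real.log_mul (by simpa using hA) (stdGaussianDensity_pos x).ne', abs_inv, Real.log_inv]
  simp_rw [hlog]
  rw [integral_add (integrable_const _) integrable_log_stdGaussianDensity]
  simp
  ring

/-- The translates of `ν` form a Markov kernel that disintegrates the joint law, and conditional
distributions are a.e. unique. -/
lemma condDistrib_add_fst (μ ν : Measure (EuclideanSpace ℝ ι)) [IsProbabilityMeasure μ]
    [IsProbabilityMeasure ν] :
    ∀ᵐ y ∂μ, condDistrib (fun q : EuclideanSpace ℝ ι × EuclideanSpace ℝ ι => q.1 + q.2)
      (fun q => q.1) (μ.prod ν) y = ν.map fun z => y + z := by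
  have hm : Measurable fun q : EuclideanSpace ℝ ι × EuclideanSpace ℝ ι => q.1 + q.2 := by fun_prop
  set k : Kernel (EuclideanSpace ℝ ι) (EuclideanSpace ℝ ι) :=
    (Kernel.id ×ₖ Kernel.const _ ν).map fun q => q.1 + q.2 with hk
  have hkapp : ∀ y, k y = ν.map fun z => y + z := by
    intro y
    rw [hk, Kernel.map_apply _ hm, Kernel.prod_apply, Kernel.id_apply, Kernel.const_apply,
      Measure.dirac_prod, Measure.map_map hm (by fun_prop)]
    rfl
  have hfst : (μ.prod ν).map (fun q => q.1) = μ := by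
    simp
  have : IsMarkovKernel k := Kernel.IsMarkovKernel.map _ hm
  have h := condDistrib_ae_eq_of_measure_eq_compProd
    (μ := μ.prod ν) (Y := fun q : EuclideanSpace ℝ ι × EuclideanSpace ℝ ι => q.1 + q.2)
    (fun q : EuclideanSpace ℝ ι × EuclideanSpace ℝ ι => q.1) hm.aemeasurable (κ := k) ?_
  · rw [hfst] at h
    filter_upwards [h] with y hy
    rw [hy, hkapp]
  · rw [hfst]
    ext s hs
    rw [Measure.compProd_apply hs, Measure.map_apply (by fun_prop) hs,
      Measure.prod_apply (hs.preimage (by fun_prop))]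
    refine lintegral_congr fun y => ?_
    rw [hkapp, Measure.map_apply (by fun_prop) (hs.preimage (by fun_prop))]
    rfl

variable [DecidableEq ι]

theorem diffEntropy_multivariateGaussian (v : EuclideanSpace ℝ ι) {S : Matrix ι ι ℝ}
    (hS : S.PosDef) :
    diffEntropy (multivariateGaussian v S) = Real.log S.det / 2
        - ∫ x, Real.log (stdGaussianDensity _ x) ∂(stdGaussian (EuclideanSpace ℝ ι)) := by
  have hdet : LinearMap.det ((Matrix.toEuclideanCLM (𝕜 := ℝ) (CFC.sqrt S) :
      EuclideanSpace ℝ ι →L[ℝ] EuclideanSpace ℝ ι) : EuclideanSpace ℝ ι →ₗ[ℝ] EuclideanSpace ℝ ι)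
      = (CFC.sqrt S).det := by
    rw [Matrix.coe_toEuclideanCLM_eq_toEuclideanLin]
    exact LinearMap.det_toLpLin _ _
  have hsq : (CFC.sqrt S).det * (CFC.sqrt S).det = S.det := by
    rw [← Matrix.det_mul, CFC.sqrt_mul_sqrt_self _ hS.posSemidef.nonneg]
  have hne : (CFC.sqrt S).det ≠ 0 := by
    intro h
    rw [h, zero_mul] at hsq
    exact hS.det_pos.ne hsq
  rw [multivariateGaussian, diffEntropy_map_affine_stdGaussian _ _ (by rwa [hdet]), hdet, ← hsq,
    Real.log_mul hne hne, Real.log_abs]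
  ring

/-- Given the signal, the sum is a translate of the noise, so only the entropies of `N(0, K + N)`
and of translates of `N(0, N)` occur. Hence `K` may be singular, and the entropy of the standard
Gaussian cancels without being computed. -/
theorem mutualInfo_gaussian {K N : Matrix ι ι ℝ} (hK : K.PosSemidef) (hN : N.PosDef) :
    mutualInfo
      (fun q : EuclideanSpace ℝ ι × EuclideanSpace ℝ ι => q.1 + q.2)
      (fun q : EuclideanSpace ℝ ι × EuclideanSpace ℝ ι => q.1)
      ((multivariateGaussian 0 K).prod (multivariateGaussian 0 N)) =
      Real.log (K + N).det / 2 - Real.log N.det / 2 := by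
  have hKN : (K + N).PosDef := Matrix.PosDef.posSemidef_add hK hN
  have hsum : ((multivariateGaussian 0 K).prod (multivariateGaussian 0 N)).map
      (fun q : EuclideanSpace ℝ ι × EuclideanSpace ℝ ι => q.1 + q.2)
      = multivariateGaussian 0 (K + N) := by
    change (multivariateGaussian 0 K) ∗ (multivariateGaussian 0 N) = _
    apply Measure.ext_of_charFun
    ext t
    rw [charFun_conv, charFun_multivariateGaussian hK, charFun_multivariateGaussian hN.posSemidef,
      charFun_multivariateGaussian hKN.posSemidef, ← Complex.exp_add, Matrix.add_mulVec,
      dotProduct_add]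
    push_cast
    congr 1
    simp
    ring
  have hfst : ((multivariateGaussian 0 K).prod (multivariateGaussian 0 N)).map (fun q => q.1)
      = multivariateGaussian 0 K := by
    simp
  have hshift : ∀ y, (multivariateGaussian 0 N).map (fun z => y + z)
      = multivariateGaussian y N := by
    intro y
    rw [multivariateGaussian, Measure.map_map (by fun_prop) (by fun_prop), multivariateGaussian]
    congr 1
    ext x
    simp
  rw [mutualInfo, hsum, diffEntropy_multivariateGaussian _ hKN, condDiffEntropy, hfst]
  have hc : ∀ᵐ y ∂(multivariateGaussian 0 K), diffEntropy (condDistrib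
      (fun q : EuclideanSpace ℝ ι × EuclideanSpace ℝ ι => q.1 + q.2)
      (fun q => q.1) ((multivariateGaussian 0 K).prod (multivariateGaussian 0 N)) y) =
      Real.log N.det / 2
        - ∫ x, Real.log (stdGaussianDensity _ x) ∂(stdGaussian (EuclideanSpace ℝ ι)) := by
    filter_upwards [condDistrib_add_fst (multivariateGaussian 0 K) (multivariateGaussian 0 N)]
      with y hy
    rw [hy, hshift, diffEntropy_multivariateGaussian _ hN]
  rw [integral_congr_ae hc]
  simp

end GaussianInformation

/-! ### The posterior covariance operator on the Hilbert space -/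

section PosteriorOperator

variable {H : Type*} [NormedAddCommGroup H] [InnerProductSpace ℝ H]

local notation "⟪" u ", " v "⟫" => inner ℝ u v

/-- The operator `η² (η² + ∑ j < t, φ j ⊗ φ j)⁻¹`, by recursive rank-one updates. -/
noncomputable def postOp (η : ℝ) (φ : ℕ → H) : ℕ → H → H
  | 0, v => v
  | t + 1, v => postOp η φ t v -
      (⟪φ t, postOp η φ t v⟫ / (η ^ 2 + ⟪φ t, postOp η φ t (φ t)⟫)) • postOp η φ t (φ t)

lemma postOp_add_smul (η : ℝ) (φ : ℕ → H) (t : ℕ) (u v : H) (c : ℝ) :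
    postOp η φ t (u + c • v) = postOp η φ t u + c • postOp η φ t v := by
  induction t with
  | zero => rfl
  | succ t ih =>
    simp only [postOp, ih, inner_add_right, inner_smul_right]
    module

/-- Pair the equation with `w`; the rank-one terms contribute squares. For `w = A v` this says `A² ≤
A`. -/
lemma norm_sq_le_of_resolvent {η : ℝ} (hη : 0 < η) {ι : Type*} {s : Finset ι} {ψ : ι → H}
    {v w : H} (h : η ^ 2 • w + ∑ j ∈ s, ⟪ψ j, w⟫ • ψ j = η ^ 2 • v) : ‖w‖ ^ 2 ≤ ⟪v, w⟫ := by
  have h1 := congrArg (fun z => ⟪z, w⟫) h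
  simp only [inner_add_left, real_inner_smul_left, sum_inner, real_inner_self_eq_norm_sq] at h1
  have h2 : 0 ≤ ∑ j ∈ s, ⟪ψ j, w⟫ * ⟪ψ j, w⟫ := Finset.sum_nonneg fun j _ => mul_self_nonneg _
  have h3 : η ^ 2 * ‖w‖ ^ 2 ≤ η ^ 2 * ⟪v, w⟫ := by linarith
  exact le_of_mul_le_mul_left h3 (by positivity)

variable {η : ℝ} (hη : 0 < η) (φ : ℕ → H) (t : ℕ)
include hη

/-- Sherman–Morrison: the update coefficient `c` is chosen so that the new coordinate `⟪φ t, ·⟫`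
equals `c η²`, which cancels the vector subtracted. Symmetry and the quadratic bounds below follow
from this identity rather than from the recursion. -/
theorem postOp_resolvent (v : H) :
    η ^ 2 • postOp η φ t v + ∑ j ∈ Finset.range t, ⟪φ j, postOp η φ t v⟫ • φ j = η ^ 2 • v := by
  induction t generalizing v with
  | zero => simp [postOp]
  | succ t ih =>
    have hs : 0 ≤ ⟪φ t, postOp η φ t (φ t)⟫ :=
      (sq_nonneg _).trans (norm_sq_le_of_resolvent hη (ih (φ t)))
    rw [Finset.sum_range_succ]
    simp only [postOp]
    set s := ⟪φ t, postOp η φ t (φ t)⟫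
    have hne : η ^ 2 + s ≠ 0 := by positivity
    set a := ⟪φ t, postOp η φ t v⟫
    set c := a / (η ^ 2 + s) with hc
    have h1 : a - c * s = c * η ^ 2 := by rw [hc]; field_simp; ring
    have e1 : ∑ j ∈ Finset.range t, ⟪φ j, postOp η φ t v - c • postOp η φ t (φ t)⟫ • φ j
        = ∑ j ∈ Finset.range t, ⟪φ j, postOp η φ t v⟫ • φ j
          - c • ∑ j ∈ Finset.range t, ⟪φ j, postOp η φ t (φ t)⟫ • φ j := by
      rw [Finset.smul_sum, ← Finset.sum_sub_distrib]
      refine Finset.sum_congr rfl fun j _ => ?_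
      rw [inner_sub_right, inner_smul_right]
      module
    have e2 : ⟪φ t, postOp η φ t v - c • postOp η φ t (φ t)⟫ = c * η ^ 2 := by
      rw [inner_sub_right, inner_smul_right, ← h1]
    rw [e1, e2, eq_sub_of_add_eq' (ih v), eq_sub_of_add_eq' (ih (φ t))]
    module

lemma norm_postOp_sq_le (v : H) : ‖postOp η φ t v‖ ^ 2 ≤ ⟪v, postOp η φ t v⟫ :=
  norm_sq_le_of_resolvent hη (postOp_resolvent hη φ t v)

lemma inner_postOp_self_nonneg (v : H) : 0 ≤ ⟪v, postOp η φ t v⟫ :=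
  (sq_nonneg _).trans (norm_postOp_sq_le hη φ t v)

lemma inner_postOp_self_le (v : H) : ⟪v, postOp η φ t v⟫ ≤ ‖v‖ ^ 2 := by
  have h1 := norm_postOp_sq_le hη φ t v
  have h2 := real_inner_le_norm v (postOp η φ t v)
  nlinarith [sq_nonneg (‖v‖ - ‖postOp η φ t v‖)]

lemma postOp_symm (u v : H) : ⟪u, postOp η φ t v⟫ = ⟪v, postOp η φ t u⟫ := by
  have h1 := congrArg (fun z => ⟪z, postOp η φ t v⟫) (postOp_resolvent hη φ t u)
  have h2 := congrArg (fun z => ⟪z, postOp η φ t u⟫) (postOp_resolvent hη φ t v)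
  simp only [inner_add_left, real_inner_smul_left, sum_inner] at h1 h2
  have h3 : η ^ 2 * ⟪u, postOp η φ t v⟫ = η ^ 2 * ⟪v, postOp η φ t u⟫ := by
    rw [← h1, ← h2, real_inner_comm]
    congr 1
    exact Finset.sum_congr rfl fun j _ => mul_comm _ _
  exact mul_left_cancel₀ (by positivity) h3

/-- Cauchy–Schwarz for a positive semidefinite form, via the discriminant of `c ↦ ⟪u + c v, A (u + c
v)⟫`. -/
lemma inner_postOp_sq_le (u v : H) :
    ⟪u, postOp η φ t v⟫ ^ 2 ≤ ⟪u, postOp η φ t u⟫ * ⟪v, postOp η φ t v⟫ := by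
  have h : ∀ c : ℝ, 0 ≤ ⟪v, postOp η φ t v⟫ * (c * c) + 2 * ⟪u, postOp η φ t v⟫ * c
      + ⟪u, postOp η φ t u⟫ := by
    intro c
    have h1 := inner_postOp_self_nonneg hη φ t (u + c • v)
    rw [postOp_add_smul, inner_add_left, inner_add_right, inner_add_right, real_inner_smul_left,
      real_inner_smul_left, inner_smul_right, inner_smul_right, postOp_symm hη φ t v u] at h1
    linarith
  have h2 := discrim_le_zero h
  rw [discrim] at h2
  nlinarith

/-- Quadratic form of the updated operator at an updated vector. -/
lemma inner_postOp_succ (u : H) (c : ℝ) :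
    ⟪u + c • φ t, postOp η φ (t + 1) (u + c • φ t)⟫ = ⟪u, postOp η φ t u⟫ +
      (2 * ⟪φ t, postOp η φ t u⟫ * c * η ^ 2 + ⟪φ t, postOp η φ t (φ t)⟫ * c ^ 2 * η ^ 2
        - ⟪φ t, postOp η φ t u⟫ ^ 2) / (η ^ 2 + ⟪φ t, postOp η φ t (φ t)⟫) := by
  have hs := inner_postOp_self_nonneg hη φ t (φ t)
  simp only [postOp, postOp_add_smul, inner_add_left, inner_add_right, inner_sub_right,
    real_inner_smul_left, inner_smul_right, postOp_symm hη φ t u (φ t)]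
  set s := ⟪φ t, postOp η φ t (φ t)⟫
  have : η ^ 2 + s ≠ 0 := by positivity
  field_simp
  ring

end PosteriorOperator

/-! ### Regularized Gram matrices: inverse and determinant -/

section Matrices

variable {H : Type*} [NormedAddCommGroup H] [InnerProductSpace ℝ H]

local notation "⟪" u ", " v "⟫" => inner ℝ u v

lemma posDef_sq_smul_one {ι : Type*} [DecidableEq ι] {η : ℝ} (hη : 0 < η) : (η ^ 2 • (1 : Matrix ι ι ℝ)).PosDef :=
  Matrix.PosDef.one.smul (by positivity)

lemma posSemidef_of_inner {ι : Type*} [Finite ι] (ψ : ι → H) : (Matrix.of fun i j => ⟪ψ i, ψ j⟫).PosSemidef :=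
  Matrix.posSemidef_gram ℝ ψ

variable {ι : Type*} [Fintype ι] [DecidableEq ι]

/-- The regularized Gram matrix. -/
noncomputable def ridgeGram (η : ℝ) (ψ : ι → H) : Matrix ι ι ℝ :=
  Matrix.of (fun i j => ⟪ψ i, ψ j⟫) + η ^ 2 • (1 : Matrix ι ι ℝ)

lemma posDef_ridgeGram {η : ℝ} (hη : 0 < η) (ψ : ι → H) : (ridgeGram η ψ).PosDef :=
  Matrix.PosDef.posSemidef_add (posSemidef_of_inner ψ) (posDef_sq_smul_one hη)

/-- The push-through identity `(ΨΨᵀ + η²)⁻¹ Ψ = Ψ (ΨᵀΨ + η²)⁻¹`: testing the resolvent equation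
against each `ψ i` gives the matrix equation. -/
lemma ridgeGram_inv_mulVec {η : ℝ} (hη : 0 < η) {ψ : ι → H} {v w : H}
    (h : η ^ 2 • w + ∑ i, ⟪ψ i, w⟫ • ψ i = η ^ 2 • v) :
    (ridgeGram η ψ)⁻¹ *ᵥ (fun i => ⟪ψ i, v⟫) = fun i => ⟪ψ i, w⟫ / η ^ 2 := by
  have hu : IsUnit (ridgeGram η ψ).det := (posDef_ridgeGram hη ψ).det_pos.ne'.isUnit
  have h1 : ridgeGram η ψ *ᵥ (fun i => ⟪ψ i, w⟫ / η ^ 2) = fun i => ⟪ψ i, v⟫ := by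
    ext i
    have h2 := congrArg (fun z => ⟪ψ i, z⟫) h
    simp only [inner_add_right, inner_smul_right, inner_sum] at h2
    rw [ridgeGram, Matrix.add_mulVec, Matrix.smul_mulVec, Matrix.one_mulVec]
    simp only [Pi.add_apply, Pi.smul_apply, Matrix.mulVec, dotProduct, Matrix.of_apply,
      smul_eq_mul]
    have h3 : ∑ j, ⟪ψ i, ψ j⟫ * (⟪ψ j, w⟫ / η ^ 2)
        = (∑ j, ⟪ψ j, w⟫ * ⟪ψ i, ψ j⟫) / η ^ 2 := by
      rw [Finset.sum_div]
      exact Finset.sum_congr rfl fun j _ => by ring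
    rw [h3, eq_sub_of_add_eq' h2]
    field_simp
    ring
  rw [← h1, Matrix.mulVec_mulVec, Matrix.nonsing_inv_mul _ hu, Matrix.one_mulVec]

/-- Adding a point multiplies the determinant by a Schur complement, which is `η²` plus the
posterior variance at that point. -/
theorem det_ridgeGram {η : ℝ} (hη : 0 < η) (φ : ℕ → H) (n : ℕ) :
    (ridgeGram η fun i : Fin n => φ i).det =
      ∏ j ∈ Finset.range n, (η ^ 2 + ⟪φ j, postOp η φ j (φ j)⟫) := by
  induction n with
  | zero => simp
  | succ n ih =>
    rw [Finset.prod_range_succ, ← ih]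
    set G := ridgeGram η fun i : Fin n => φ i with hG
    have hu : IsUnit G.det := (posDef_ridgeGram hη _).det_pos.ne'.isUnit
    let _ : Invertible G := G.invertibleOfIsUnitDet hu
    have hblocks : (ridgeGram η fun i : Fin (n + 1) => φ i).submatrix finSumFinEquiv finSumFinEquiv
        = Matrix.fromBlocks G (Matrix.of fun i (_ : Fin 1) => ⟪φ i, φ n⟫)
          (Matrix.of fun (_ : Fin 1) i => ⟪φ n, φ i⟫)
          (Matrix.of fun _ _ => ⟪φ n, φ n⟫ + η ^ 2) := by
      ext i j
      rcases i with i | i <;> rcases j with j | j <;>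
        simp [ridgeGram, hG, Matrix.one_apply, Fin.ext_iff, Fin.val_eq_zero]
      · have := i.2; omega
      · have := j.2; omega
    have hinv : G⁻¹ * (Matrix.of fun (i : Fin n) (_ : Fin 1) => ⟪φ i, φ n⟫)
        = Matrix.of fun (i : Fin n) (_ : Fin 1) => ⟪φ i, postOp η φ n (φ n)⟫ / η ^ 2 := by
      have h := ridgeGram_inv_mulVec hη (ψ := fun i : Fin n => φ i) (v := φ n)
        (w := postOp η φ n (φ n)) (by
          have := postOp_resolvent hη φ n (φ n)
          rwa [← Fin.sum_univ_eq_sum_range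
            (fun j => ⟪φ j, postOp η φ n (φ n)⟫ • φ j)] at this)
      ext i j
      exact congrFun h i
    rw [← Matrix.det_submatrix_equiv_self finSumFinEquiv, hblocks, Matrix.det_fromBlocks₁₁,
      Matrix.invOf_eq_nonsing_inv, Matrix.mul_assoc, hinv, Matrix.det_fin_one]
    congr 1
    have h2 := congrArg (fun z => ⟪φ n, z⟫) (postOp_resolvent hη φ n (φ n))
    simp only [inner_add_right, inner_smul_right, inner_sum] at h2
    simp only [Matrix.sub_apply, Matrix.of_apply, Matrix.mul_apply]
    rw [Fin.sum_univ_eq_sum_range (fun j => ⟪φ n, φ j⟫ * (⟪φ j, postOp η φ n (φ n)⟫ / η ^ 2))]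
    have h3 : ∑ j ∈ Finset.range n, ⟪φ n, φ j⟫ * (⟪φ j, postOp η φ n (φ n)⟫ / η ^ 2)
        = (∑ j ∈ Finset.range n, ⟪φ j, postOp η φ n (φ n)⟫ * ⟪φ n, φ j⟫) / η ^ 2 := by
      rw [Finset.sum_div]
      exact Finset.sum_congr rfl fun j _ => by ring
    rw [h3, eq_sub_of_add_eq' h2]
    field_simp
    ring

end Matrices

/-! ### Kernel posterior in feature space, and the maximum information gain -/

section FeatureMap

variable {H : Type*} [NormedAddCommGroup H] [InnerProductSpace ℝ H]

local notation "⟪" u ", " v "⟫" => inner ℝ u v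

variable {X : Type*} {κ : X → X → ℝ} {φ : X → H} (hκ : ∀ x y, κ x y = ⟪φ x, φ y⟫)
  {η : ℝ} (hη : 0 < η)

/-- The posterior covariance after observations at `xs 0, …, xs (t - 1)`. -/
noncomputable def postCov (η : ℝ) (φ : X → H) (xs : ℕ → X) (t : ℕ) (x x' : X) : ℝ :=
  ⟪φ x, postOp η (fun j => φ (xs j)) t (φ x')⟫

include hη in
lemma postCov_self_nonneg (xs : ℕ → X) (t : ℕ) (x : X) : 0 ≤ postCov η φ xs t x x :=
  inner_postOp_self_nonneg hη _ t _

include hη hκ in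
lemma postCov_self_le (xs : ℕ → X) (t : ℕ) (x : X) : postCov η φ xs t x x ≤ κ x x := by
  rw [hκ, real_inner_self_eq_norm_sq]
  exact inner_postOp_self_le hη _ t _

include hκ in
lemma regGram_eq_ridgeGram (s : Finset ℕ) (xs : ℕ → X) :
    regGram κ η s xs = ridgeGram η fun i : s => φ (xs i) := by
  ext i j
  simp [regGram, ridgeGram, hκ]

include hκ hη in
lemma regGram_inv_mulVec_crossVec (xs : ℕ → X) (t : ℕ) (x : X) :
    (regGram κ η (Finset.range t) xs)⁻¹ *ᵥ crossVec κ (Finset.range t) xs x =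
      fun i : Finset.range t => postCov η φ xs t (xs i) x / η ^ 2 := by
  have hc : crossVec κ (Finset.range t) xs x = fun i : Finset.range t => ⟪φ (xs i), φ x⟫ := by
    ext i
    rw [crossVec, hκ, real_inner_comm]
  rw [regGram_eq_ridgeGram hκ, hc]
  refine ridgeGram_inv_mulVec hη ?_
  have := postOp_resolvent hη (fun j => φ (xs j)) t (φ x)
  rwa [← Finset.sum_coe_sort] at this

include hκ hη in
theorem postVar_range (xs : ℕ → X) (t : ℕ) (x : X) :
    postVar κ η (Finset.range t) xs x = postCov η φ xs t x x := by
  rw [postVar, regGram_inv_mulVec_crossVec hκ hη]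
  simp only [dotProduct, crossVec]
  rw [Finset.sum_coe_sort (Finset.range t) fun j => κ x (xs j) * (postCov η φ xs t (xs j) x / η ^ 2)]
  have h := congrArg (fun z => ⟪φ x, z⟫) (postOp_resolvent hη (fun j => φ (xs j)) t (φ x))
  simp only [inner_add_right, inner_smul_right, inner_sum] at h
  have h3 : ∑ j ∈ Finset.range t, κ x (xs j) * (postCov η φ xs t (xs j) x / η ^ 2)
      = (∑ j ∈ Finset.range t, ⟪φ (xs j), postOp η (fun j => φ (xs j)) t (φ x)⟫
        * ⟪φ x, φ (xs j)⟫) / η ^ 2 := by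
    rw [Finset.sum_div]
    exact Finset.sum_congr rfl fun j _ => by rw [hκ, postCov]; ring
  rw [h3, eq_sub_of_add_eq' h, hκ, postCov]
  field_simp
  ring

include hκ hη in
theorem postMean_range (xs : ℕ → X) (ys : ℕ → ℝ) (t : ℕ) (x : X) :
    postMean κ η (Finset.range t) xs ys x =
      (∑ j ∈ Finset.range t, postCov η φ xs t (xs j) x * ys j) / η ^ 2 := by
  have hsymm : (regGram κ η (Finset.range t) xs)⁻¹ᵀ = (regGram κ η (Finset.range t) xs)⁻¹ := by
    rw [Matrix.transpose_nonsing_inv]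
    congr 1
    rw [regGram_eq_ridgeGram hκ]
    ext i j
    simp [ridgeGram, Matrix.one_apply, real_inner_comm, eq_comm]
  rw [postMean, Matrix.dotProduct_mulVec, ← Matrix.mulVec_transpose, hsymm,
    regGram_inv_mulVec_crossVec hκ hη, Finset.sum_div]
  simp only [dotProduct]
  rw [Finset.sum_coe_sort (Finset.range t) fun j => postCov η φ xs t (xs j) x / η ^ 2 * ys j]
  exact Finset.sum_congr rfl fun j _ => by ring

/-- Half the log-determinant of `1 + η⁻² K` for the points `xs 0, …, xs (n - 1)`. -/
noncomputable def halfLogDet (η : ℝ) (φ : X → H) (xs : ℕ → X) (n : ℕ) : ℝ :=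
  (∑ j ∈ Finset.range n, Real.log (1 + postCov η φ xs j (xs j) (xs j) / η ^ 2)) / 2

include hκ hη in
theorem infoGain_eq_halfLogDet (xs : ℕ → X) (n : ℕ) :
    infoGain κ η (fun i : Fin n => xs i) = halfLogDet η φ xs n := by
  have hK : (Matrix.of fun i j : Fin n => κ (xs i) (xs j))
      = Matrix.of fun i j : Fin n => ⟪φ (xs i), φ (xs j)⟫ := by simp only [hκ]
  have hd := det_ridgeGram hη (fun j => φ (xs j)) n
  rw [ridgeGram] at hd
  rw [infoGain, mutualInfo_gaussian (by rw [hK]; exact posSemidef_of_inner _)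
    (posDef_sq_smul_one hη), hK, hd, Matrix.det_smul, Matrix.det_one, mul_one, Fintype.card_fin,
    Real.log_prod (fun j _ => (add_pos_of_pos_of_nonneg (by positivity)
      (inner_postOp_self_nonneg hη _ _ _)).ne'), Real.log_pow, halfLogDet, ← sub_div]
  congr 1
  rw [show (n : ℝ) * Real.log (η ^ 2) = ∑ _j ∈ Finset.range n, Real.log (η ^ 2) by simp,
    ← Finset.sum_sub_distrib]
  refine Finset.sum_congr rfl fun j _ => ?_
  have h0 := postCov_self_nonneg (φ := φ) hη xs j (xs j)
  rw [← Real.log_div (by unfold postCov at h0; positivity) (by positivity), postCov]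
  congr 1
  field_simp

include hη in
lemma halfLogDet_mono (xs : ℕ → X) : Monotone (halfLogDet η φ xs) := by
  refine monotone_nat_of_le_succ fun n => ?_
  rw [halfLogDet, halfLogDet, Finset.sum_range_succ]
  have h0 := postCov_self_nonneg (φ := φ) hη xs n (xs n)
  have := Real.log_nonneg (x := 1 + postCov η φ xs n (xs n) (xs n) / η ^ 2)
    (by have : 0 ≤ postCov η φ xs n (xs n) (xs n) / η ^ 2 := by positivity
        linarith)
  linarith

lemma exists_extension [Nonempty X] {n : ℕ} (x : Fin n → X) :
    ∃ xs : ℕ → X, x = fun i : Fin n => xs i := by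
  classical
  refine ⟨fun j => if h : j < n then x ⟨j, h⟩ else Classical.arbitrary X, ?_⟩
  ext i
  simp

variable {M : ℝ} (hM : ∀ x, κ x x ≤ M)

include hκ hη hM in
lemma halfLogDet_le (xs : ℕ → X) (n : ℕ) : halfLogDet η φ xs n ≤ n * (M / η ^ 2) / 2 := by
  rw [halfLogDet]
  have : ∑ j ∈ Finset.range n, Real.log (1 + postCov η φ xs j (xs j) (xs j) / η ^ 2)
      ≤ ∑ _j ∈ Finset.range n, M / η ^ 2 := by
    refine Finset.sum_le_sum fun j _ => ?_
    have h0 := postCov_self_nonneg (φ := φ) hη xs j (xs j)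
    have h1 := (postCov_self_le hκ hη xs j (xs j)).trans (hM _)
    have h2 : postCov η φ xs j (xs j) (xs j) / η ^ 2 ≤ M / η ^ 2 := by gcongr
    have h3 := Real.log_le_sub_one_of_pos
      (x := 1 + postCov η φ xs j (xs j) (xs j) / η ^ 2) (by positivity)
    linarith
  simp only [Finset.sum_const, Finset.card_range, nsmul_eq_mul] at this
  linarith

variable [Nonempty X]

-- A real supremum over an unbounded range would be the junk value `0`, so `Φ_n` dominates its
-- members only because of this bound. It comes from `log (1 + u) ≤ u` and posterior variances at
-- most `M`.
include hκ hη hM in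
lemma bddAbove_infoGain (n : ℕ) : BddAbove (Set.range fun x : Fin n → X => infoGain κ η x) := by
  refine ⟨n * (M / η ^ 2) / 2, ?_⟩
  rintro _ ⟨x, rfl⟩
  obtain ⟨xs, rfl⟩ := exists_extension x
  simp only [infoGain_eq_halfLogDet hκ hη]
  exact halfLogDet_le hκ hη hM xs n

include hκ hη hM in
theorem halfLogDet_le_maxInfoGain (xs : ℕ → X) (n : ℕ) :
    halfLogDet η φ xs n ≤ maxInfoGain κ η n := by
  rw [← infoGain_eq_halfLogDet hκ hη]
  exact le_ciSup (bddAbove_infoGain hκ hη hM n) _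

include hκ hη hM in
lemma maxInfoGain_mono : Monotone (maxInfoGain κ η) := by
  intro m n hmn
  refine ciSup_le fun x => ?_
  obtain ⟨xs, rfl⟩ := exists_extension x
  rw [infoGain_eq_halfLogDet hκ hη]
  exact (halfLogDet_mono hη xs hmn).trans (halfLogDet_le_maxInfoGain hκ hη hM xs n)

include hκ hη hM in
lemma maxInfoGain_nonneg (n : ℕ) : 0 ≤ maxInfoGain κ η n := by
  have h := halfLogDet_le_maxInfoGain hκ hη hM (fun _ => Classical.arbitrary X) n
  have h0 := halfLogDet_mono (φ := φ) hη (fun _ => Classical.arbitrary X) (Nat.zero_le n)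
  have : halfLogDet η φ (fun _ => Classical.arbitrary X) 0 = 0 := by simp [halfLogDet]
  linarith

-- Keeps `Φ` away from `0`, which lets the summand `1` in the multiplier be absorbed into a
-- constant.
include hκ hη hM in
lemma maxInfoGain_one_pos {x : X} (hx : 0 < κ x x) : 0 < maxInfoGain κ η 1 := by
  refine lt_of_lt_of_le ?_ (halfLogDet_le_maxInfoGain hκ hη hM (fun _ => x) 1)
  rw [hκ] at hx
  simp only [halfLogDet, Finset.range_one, Finset.sum_singleton, postCov, postOp]
  have : 0 < ⟪φ x, φ x⟫ / η ^ 2 := by positivity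
  have := Real.log_pos (x := 1 + ⟪φ x, φ x⟫ / η ^ 2) (by linarith)
  linarith

include hκ hη hM in
/-- The sum of the posterior variances at the observed points is bounded by the information gain. -/
theorem sum_postCov_le (xs : ℕ → X) (n : ℕ) :
    ∑ j ∈ Finset.range n, postCov η φ xs j (xs j) (xs j) ≤
      2 * (η ^ 2 + M) * maxInfoGain κ η n := by
  have hM0 : 0 ≤ M := by
    have := hM (xs 0)
    rw [hκ] at this
    exact real_inner_self_nonneg.trans this
  have h : ∀ j, postCov η φ xs j (xs j) (xs j) ≤
      (η ^ 2 + M) * Real.log (1 + postCov η φ xs j (xs j) (xs j) / η ^ 2) := by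
    intro j
    have h0 := postCov_self_nonneg (φ := φ) hη xs j (xs j)
    have h1 := (postCov_self_le hκ hη xs j (xs j)).trans (hM _)
    set s := postCov η φ xs j (xs j) (xs j)
    -- `log (1 + u) ≥ u / (1 + u)` with `u = s / η²`; the factor `η² + s` is then at most `η² + M`.
    have h2 := Real.one_sub_inv_le_log_of_pos (x := 1 + s / η ^ 2) (by positivity)
    have h3 : 1 - (1 + s / η ^ 2)⁻¹ = s / (η ^ 2 + s) := by field_simp; ring
    rw [h3] at h2
    calc s = (η ^ 2 + s) * (s / (η ^ 2 + s)) := by field_simp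
      _ ≤ (η ^ 2 + M) * Real.log (1 + s / η ^ 2) := by gcongr
  calc _ ≤ ∑ j ∈ Finset.range n, (η ^ 2 + M) *
        Real.log (1 + postCov η φ xs j (xs j) (xs j) / η ^ 2) := Finset.sum_le_sum fun j _ => h j
    _ = 2 * (η ^ 2 + M) * halfLogDet η φ xs n := by
      rw [← Finset.mul_sum, halfLogDet]; ring
    _ ≤ _ := by
      gcongr
      exact halfLogDet_le_maxInfoGain hκ hη hM xs n

/-! ### The confidence width -/

/-- The noise-weighted sum of features. -/
noncomputable def noiseSum (φ : X → H) (xs : ℕ → X) (ξ : ℕ → ℝ) (t : ℕ) : H :=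
  ∑ j ∈ Finset.range t, ξ j • φ (xs j)

/-- `⟪S, A S⟫` for the noise sum `S` and the posterior operator `A`. -/
noncomputable def noiseEnergy (η : ℝ) (φ : X → H) (xs : ℕ → X) (ξ : ℕ → ℝ) (t : ℕ) : ℝ :=
  ⟪noiseSum φ xs ξ t, postOp η (fun j => φ (xs j)) t (noiseSum φ xs ξ t)⟫

-- Splitting each observation into `g` and noise, the resolvent equation turns the error into `⟪S, A
-- φ(x)⟫ / η² - ⟪g, A φ(x)⟫`. The noise part uses Cauchy–Schwarz for `A`, the bias part `‖A v‖² ≤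
-- ⟪v, A v⟫`.
omit [Nonempty X] in
include hκ hη in
theorem abs_postMean_sub_le (g : H) (xs : ℕ → X) (ys : ℕ → ℝ) (t : ℕ) (x : X) :
    |postMean κ η (Finset.range t) xs ys x - ⟪g, φ x⟫| ≤
      (‖g‖ + √(noiseEnergy η φ xs (fun j => ys j - ⟪g, φ (xs j)⟫) t) / η ^ 2)
        * postSD κ η (Finset.range t) xs x := by
  set A := postOp η (fun j => φ (xs j)) t with hA
  set S := noiseSum φ xs (fun j => ys j - ⟪g, φ (xs j)⟫) t with hS
  have hdec : postMean κ η (Finset.range t) xs ys x - ⟪g, φ x⟫ =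
      ⟪S, A (φ x)⟫ / η ^ 2 - ⟪g, A (φ x)⟫ := by
    have h := congrArg (fun z => ⟪g, z⟫) (postOp_resolvent hη (fun j => φ (xs j)) t (φ x))
    simp only [inner_add_right, inner_smul_right, inner_sum] at h
    rw [postMean_range hκ hη, hS, noiseSum, sum_inner]
    simp only [real_inner_smul_left, sub_mul, Finset.sum_sub_distrib]
    have e1 : ∑ j ∈ Finset.range t, postCov η φ xs t (xs j) x * ys j
        = ∑ j ∈ Finset.range t, ys j * ⟪φ (xs j), A (φ x)⟫ :=
      Finset.sum_congr rfl fun j _ => mul_comm _ _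
    have e2 : ∑ j ∈ Finset.range t, ⟪g, φ (xs j)⟫ * ⟪φ (xs j), A (φ x)⟫
        = η ^ 2 * ⟪g, φ x⟫ - η ^ 2 * ⟪g, A (φ x)⟫ := by
      rw [← h, add_sub_cancel_left]
      exact Finset.sum_congr rfl fun j _ => mul_comm _ _
    rw [e1, e2]
    field_simp
    ring
  have hsd : postSD κ η (Finset.range t) xs x = √⟪φ x, A (φ x)⟫ := by
    rw [postSD, postVar_range hκ hη, postCov]
  have hb1 : |⟪S, A (φ x)⟫| ≤ √⟪S, A S⟫ * √⟪φ x, A (φ x)⟫ := by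
    rw [← Real.sqrt_mul (inner_postOp_self_nonneg hη _ t _)]
    exact Real.abs_le_sqrt (inner_postOp_sq_le hη _ t _ _)
  have hb2 : |⟪g, A (φ x)⟫| ≤ ‖g‖ * √⟪φ x, A (φ x)⟫ := by
    refine (abs_real_inner_le_norm _ _).trans ?_
    gcongr
    exact Real.le_sqrt_of_sq_le (norm_postOp_sq_le hη _ t _)
  rw [hdec, hsd]
  calc _ ≤ |⟪S, A (φ x)⟫ / η ^ 2| + |⟪g, A (φ x)⟫| := abs_sub _ _
    _ = |⟪S, A (φ x)⟫| / η ^ 2 + |⟪g, A (φ x)⟫| := by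
      rw [abs_div, abs_of_pos (show 0 < η ^ 2 by positivity)]
    _ ≤ √⟪S, A S⟫ * √⟪φ x, A (φ x)⟫ / η ^ 2 + ‖g‖ * √⟪φ x, A (φ x)⟫ := by gcongr
    _ = (‖g‖ + √⟪S, A S⟫ / η ^ 2) * √⟪φ x, A (φ x)⟫ := by ring

end FeatureMap

/-! ### Sub-Gaussian bounds for one step of the noise -/

section SubGaussian

/-- Hoeffding's lemma for a centered Bernoulli variable. -/
lemma bernoulli_hoeffding {b : ℝ} (hb0 : 0 ≤ b) (hb1 : b ≤ 1) (u : ℝ) :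
    b * Real.exp (u * (1 - b)) + (1 - b) * Real.exp (u * (-b)) ≤ Real.exp (u ^ 2 / 8) := by
  set ν : Measure ℝ := ENNReal.ofReal b • Measure.dirac (1 - b) +
    ENNReal.ofReal (1 - b) • Measure.dirac (-b) with hν
  have hprob : IsProbabilityMeasure ν := by
    constructor
    simp only [hν, Measure.coe_add, Measure.coe_smul, Pi.add_apply, Pi.smul_apply, measure_univ,
      smul_eq_mul, mul_one]
    rw [← ENNReal.ofReal_add hb0 (by linarith)]
    simp
  have hint : ∀ F : ℝ → ℝ, ∫ x, F x ∂ν = b * F (1 - b) + (1 - b) * F (-b) := by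
    intro F
    rw [hν, integral_add_measure, integral_smul_measure, integral_smul_measure, integral_dirac,
      integral_dirac, ENNReal.toReal_ofReal hb0, ENNReal.toReal_ofReal (by linarith)]
    · simp
    · exact (integrable_dirac (by finiteness)).smul_measure (by finiteness)
    · exact (integrable_dirac (by finiteness)).smul_measure (by finiteness)
  have hmem : ∀ᵐ x ∂ν, x ∈ Set.Icc (-b) (1 - b) := by
    rw [hν, ae_add_measure_iff]
    constructor
    · refine Measure.ae_smul_measure ?_ _
      rw [ae_dirac_eq]
      exact ⟨by linarith, le_rfl⟩
    · refine Measure.ae_smul_measure ?_ _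
      rw [ae_dirac_eq]
      exact ⟨le_rfl, by linarith⟩
  have h := (hasSubgaussianMGF_of_mem_Icc_of_integral_eq_zero (X := fun x => x)
    aemeasurable_id' hmem (by rw [hint]; ring)).mgf_le u
  rw [mgf, hint] at h
  refine h.trans (le_of_eq ?_)
  congr 1
  have : ‖1 - b - -b‖₊ = 1 := by
    rw [show 1 - b - -b = 1 by ring]; simp
  rw [this]
  push_cast
  ring

lemma integral_exp_gaussianPDFReal (m : ℝ) (v : NNReal) (hv : v ≠ 0) (ξ : ℝ) :
    ∫ x, gaussianPDFReal m v x * Real.exp (ξ * x) = Real.exp (m * ξ + v * ξ ^ 2 / 2) := by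
  have h := congrFun (mgf_id_gaussianReal (μ := m) (v := v)) ξ
  rw [mgf, integral_gaussianReal_eq_integral_smul hv] at h
  simpa using h

/-- The conditional expectation of the exponential of the increment of the noise energy, for
two-valued sub-Gaussian noise. -/
theorem exp_increment_le {η s a : ℝ} (hη : 0 < η) (hs : 0 ≤ s) {w₁ w₂ ξ₁ ξ₂ : ℝ}
    (hsub : ∀ u : ℝ, w₁ * Real.exp (u * ξ₁) + w₂ * Real.exp (u * ξ₂)
      ≤ Real.exp (η ^ 2 * u ^ 2 / 2)) :
    w₁ * Real.exp ((2 * a * ξ₁ * η ^ 2 + s * ξ₁ ^ 2 * η ^ 2 - a ^ 2) / (η ^ 2 + s) / (2 * η ^ 4)) +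
      w₂ * Real.exp ((2 * a * ξ₂ * η ^ 2 + s * ξ₂ ^ 2 * η ^ 2 - a ^ 2) / (η ^ 2 + s) / (2 * η ^ 4))
      ≤ √(1 + s / η ^ 2) := by
  have hη2 : 0 < η ^ 2 := by positivity
  have hK : 0 < η ^ 2 + s := by positivity
  suffices h : w₁ * Real.exp ((2 * a * ξ₁ * η ^ 2 + s * ξ₁ ^ 2 * η ^ 2) / (η ^ 2 + s) / (2 * η ^ 4))
      + w₂ * Real.exp ((2 * a * ξ₂ * η ^ 2 + s * ξ₂ ^ 2 * η ^ 2) / (η ^ 2 + s) / (2 * η ^ 4))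
      ≤ √(1 + s / η ^ 2) * Real.exp (a ^ 2 / (η ^ 2 + s) / (2 * η ^ 4)) by
    have hsplit : ∀ z, Real.exp ((z - a ^ 2) / (η ^ 2 + s) / (2 * η ^ 4)) =
        Real.exp (z / (η ^ 2 + s) / (2 * η ^ 4)) / Real.exp (a ^ 2 / (η ^ 2 + s) / (2 * η ^ 4)) := by
      intro z
      rw [← Real.exp_sub]
      congr 1
      ring
    rw [hsplit, hsplit, mul_div_assoc', mul_div_assoc', ← add_div, div_le_iff₀ (Real.exp_pos _)]
    exact h
  -- For `s = 0` the exponent is linear in the noise and the mixing Gaussian below would be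
  -- degenerate; the hypothesis at `u = a / η⁴` suffices.
  rcases hs.eq_or_lt with rfl | hs
  · have h := hsub (a / η ^ 4)
    convert h using 4
    · field_simp; ring
    · field_simp; ring
    · simp; field_simp
  set v : NNReal := (s / (η ^ 2 * (η ^ 2 + s))).toNNReal with hv
  set v' : NNReal := (s / η ^ 4).toNNReal with hv'
  have hvc : (v : ℝ) = s / (η ^ 2 * (η ^ 2 + s)) := Real.coe_toNNReal _ (by positivity)
  have hvc' : (v' : ℝ) = s / η ^ 4 := Real.coe_toNNReal _ (by positivity)
  have hv0 : v ≠ 0 := by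
    rw [← NNReal.coe_ne_zero, hvc]; positivity
  set α := a / (η ^ 2 * (η ^ 2 + s)) with hα
  -- Linearize the square: `exp (α ξ + v ξ² / 2)` is the moment generating function of `N(α, v)` at
  -- `ξ`, so under the integral the exponent is linear in `ξ`.
  have hrew : ∀ ξ : ℝ, Real.exp ((2 * a * ξ * η ^ 2 + s * ξ ^ 2 * η ^ 2) / (η ^ 2 + s) / (2 * η ^ 4))
      = ∫ x, gaussianPDFReal α v x * Real.exp (ξ * x) := by
    intro ξ
    rw [integral_exp_gaussianPDFReal _ _ hv0, hvc, hα]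
    congr 1
    field_simp
  -- After the sub-Gaussian bound, the tilt by `exp (η² x² / 2)` gives a Gaussian again: `1 / v' = 1
  -- / v - η²`, mean `α v' / v = a / η⁴`, and `√(v' / v) = √(1 + s / η²)`.
  have htilt : ∀ x, gaussianPDFReal α v x * Real.exp (η ^ 2 * x ^ 2 / 2) =
      √(1 + s / η ^ 2) * Real.exp (a ^ 2 / (η ^ 2 + s) / (2 * η ^ 4))
        * gaussianPDFReal (a / η ^ 4) v' x := by
    intro x
    rw [gaussianPDFReal, gaussianPDFReal, hvc, hvc']
    have h1 : √(2 * Real.pi * (s / η ^ 4))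
        = √(1 + s / η ^ 2) * √(2 * Real.pi * (s / (η ^ 2 * (η ^ 2 + s)))) := by
      rw [← Real.sqrt_mul (by positivity)]
      congr 1
      field_simp
    have h2 : 0 < √(1 + s / η ^ 2) := by positivity
    rw [h1, mul_inv, mul_assoc, ← Real.exp_add]
    rw [show ∀ p q e₁ e₂ : ℝ, p * e₁ * (p⁻¹ * q * e₂) = (p * p⁻¹) * (q * (e₁ * e₂)) by
      intros; ring, mul_inv_cancel₀ h2.ne', one_mul, ← Real.exp_add]
    congr 2
    rw [hα]
    field_simp
    ring
  have hintR : Integrable fun x => gaussianPDFReal α v x * Real.exp (η ^ 2 * x ^ 2 / 2) := by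
    simp_rw [htilt]
    exact (integrable_gaussianPDFReal _ _).const_mul _
  have hint : ∀ ξ : ℝ, Integrable fun x => gaussianPDFReal α v x * Real.exp (ξ * x) := by
    intro ξ
    -- A non-integrable function has integral `0` by convention, but this integral is an
    -- exponential.
    by_contra hn
    have h1 := hrew ξ
    rw [integral_undef hn] at h1
    exact (Real.exp_pos _).ne' h1
  have hv0' : v' ≠ 0 := by
    rw [← NNReal.coe_ne_zero, hvc']; positivity
  calc _ = ∫ x, (w₁ * (gaussianPDFReal α v x * Real.exp (ξ₁ * x))
        + w₂ * (gaussianPDFReal α v x * Real.exp (ξ₂ * x))) := by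
        rw [integral_add ((hint _).const_mul _) ((hint _).const_mul _), integral_const_mul,
          integral_const_mul, hrew, hrew]
    _ ≤ ∫ x, gaussianPDFReal α v x * Real.exp (η ^ 2 * x ^ 2 / 2) := by
        refine integral_mono (((hint _).const_mul _).add ((hint _).const_mul _)) hintR fun x => ?_
        have h1 := mul_le_mul_of_nonneg_left (hsub x) (gaussianPDFReal_nonneg α v x)
        simp only [mul_comm x] at h1
        linarith
    _ = _ := by
        simp_rw [htilt]
        rw [integral_const_mul, integral_gaussianPDFReal_eq_one _ hv0', mul_one]

end SubGaussian

/-! ### The exponential potential: one-step inequality, bounds and measurability -/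

section Potential

variable {H : Type*} [NormedAddCommGroup H] [InnerProductSpace ℝ H]

local notation "⟪" u ", " v "⟫" => inner ℝ u v

variable {X : Type*} {κ : X → X → ℝ} {φ : X → H} {η : ℝ}

/-- The exponential supermartingale of the noise energy. -/
noncomputable def potential (η : ℝ) (φ : X → H) (xs : ℕ → X) (ξ : ℕ → ℝ) (t : ℕ) : ℝ :=
  Real.exp (noiseEnergy η φ xs ξ t / (2 * η ^ 4) - halfLogDet η φ xs t)

lemma noiseSum_congr {xs : ℕ → X} {ξ ξ' : ℕ → ℝ} {t : ℕ} (h : ∀ j < t, ξ j = ξ' j) :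
    noiseSum φ xs ξ t = noiseSum φ xs ξ' t :=
  Finset.sum_congr rfl fun j hj => by rw [h j (Finset.mem_range.1 hj)]

lemma potential_congr {xs : ℕ → X} {ξ ξ' : ℕ → ℝ} {t : ℕ} (h : ∀ j < t, ξ j = ξ' j) :
    potential η φ xs ξ t = potential η φ xs ξ' t := by
  rw [potential, potential, noiseEnergy, noiseEnergy, noiseSum_congr h]

lemma potential_zero (xs : ℕ → X) (ξ : ℕ → ℝ) : potential η φ xs ξ 0 = 1 := by
  simp [potential, noiseEnergy, noiseSum, halfLogDet]

lemma potential_pos (xs : ℕ → X) (ξ : ℕ → ℝ) (t : ℕ) : 0 < potential η φ xs ξ t := Real.exp_pos _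

lemma potential_succ (hη : 0 < η) (xs : ℕ → X) (ξ : ℕ → ℝ) (t : ℕ) :
    potential η φ xs ξ (t + 1) = potential η φ xs ξ t *
      (Real.exp ((2 * ⟪φ (xs t), postOp η (fun j => φ (xs j)) t (noiseSum φ xs ξ t)⟫ * ξ t * η ^ 2
        + postCov η φ xs t (xs t) (xs t) * ξ t ^ 2 * η ^ 2
        - ⟪φ (xs t), postOp η (fun j => φ (xs j)) t (noiseSum φ xs ξ t)⟫ ^ 2)
          / (η ^ 2 + postCov η φ xs t (xs t) (xs t)) / (2 * η ^ 4))
        / √(1 + postCov η φ xs t (xs t) (xs t) / η ^ 2)) := by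
  have h0 := postCov_self_nonneg (φ := φ) hη xs t (xs t)
  have hsqrt : √(1 + postCov η φ xs t (xs t) (xs t) / η ^ 2)
      = Real.exp (Real.log (1 + postCov η φ xs t (xs t) (xs t) / η ^ 2) / 2) := by
    rw [← Real.log_sqrt (by positivity), Real.exp_log (by positivity)]
  rw [hsqrt, ← Real.exp_sub, potential, potential, ← Real.exp_add]
  congr 1
  have h1 := inner_postOp_succ hη (fun j => φ (xs j)) t (noiseSum φ xs ξ t) (ξ t)
  have h2 : noiseSum φ xs ξ (t + 1) = noiseSum φ xs ξ t + ξ t • φ (xs t) := by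
    rw [noiseSum, Finset.sum_range_succ, noiseSum]
  rw [noiseEnergy, h2, h1, halfLogDet, Finset.sum_range_succ, halfLogDet, noiseEnergy]
  simp only [postCov]
  ring

/-- The supermartingale property in pointwise form: the two outcomes of a comparison are averaged
explicitly, so no conditional law is needed. The new pivot of the determinant cancels the bound on
the energy increment. -/
theorem potential_step (hη : 1 / 2 ≤ η) (xs : ℕ → X) (ξ : ℕ → ℝ) (t : ℕ) {b : ℝ} (hb0 : 0 ≤ b)
    (hb1 : b ≤ 1) :
    b * potential η φ xs (Function.update ξ t (1 - b)) (t + 1)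
      + (1 - b) * potential η φ xs (Function.update ξ t (-b)) (t + 1) ≤ potential η φ xs ξ t := by
  have hη0 : 0 < η := by linarith
  have h0 := postCov_self_nonneg (φ := φ) hη0 xs t (xs t)
  have hu : ∀ c, ∀ j < t, Function.update ξ t c j = ξ j := fun c j hj =>
    Function.update_of_ne hj.ne _ _
  rw [potential_succ hη0, potential_succ hη0]
  simp only [potential_congr (hu _), noiseSum_congr (hu _), Function.update_self]
  set s := postCov η φ xs t (xs t) (xs t)
  set a := ⟪φ (xs t), postOp η (fun j => φ (xs j)) t (noiseSum φ xs ξ t)⟫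
  have hsub : ∀ u : ℝ, b * Real.exp (u * (1 - b)) + (1 - b) * Real.exp (u * (-b))
      ≤ Real.exp (η ^ 2 * u ^ 2 / 2) := by
    intro u
    -- Here `η ≥ 1/2` matters, as opposed to `η > 0`: `u² / 8 ≤ η² u² / 2`.
    refine (bernoulli_hoeffding hb0 hb1 u).trans (Real.exp_le_exp.2 ?_)
    nlinarith [mul_nonneg (sq_nonneg u) (show 0 ≤ η ^ 2 - 1 / 4 by nlinarith)]
  have h := exp_increment_le (a := a) hη0 h0 hsub
  have hq : 0 < √(1 + s / η ^ 2) := by positivity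
  have h2 := (div_le_one hq).2 h
  have h3 := mul_le_mul_of_nonneg_left h2 (potential_pos (η := η) (φ := φ) xs ξ t).le
  rw [mul_one] at h3
  refine le_trans (le_of_eq ?_) h3
  ring

/-- A crude deterministic bound that serves only for integrability. -/
theorem potential_le (hκ : ∀ x y, κ x y = ⟪φ x, φ y⟫) (hη : 0 < η) {M : ℝ}
    (hM : ∀ x, κ x x ≤ M) (xs : ℕ → X) {ξ : ℕ → ℝ} {t : ℕ} (hξ : ∀ j < t, |ξ j| ≤ 1) :
    potential η φ xs ξ t ≤ Real.exp ((t * √M) ^ 2 / (2 * η ^ 4)) := by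
  rw [potential, Real.exp_le_exp]
  have h1 : 0 ≤ halfLogDet η φ xs t := by
    have := halfLogDet_mono (φ := φ) hη xs (Nat.zero_le t)
    have : halfLogDet η φ xs 0 = 0 := by simp [halfLogDet]
    linarith
  have h2 : ‖noiseSum φ xs ξ t‖ ≤ t * √M := by
    refine (norm_sum_le _ _).trans ?_
    refine (Finset.sum_le_sum (g := fun _ => √M) fun j hj => ?_).trans (by simp)
    rw [norm_smul, Real.norm_eq_abs]
    have h3 : ‖φ (xs j)‖ ≤ √M := by
      refine Real.le_sqrt_of_sq_le ?_
      rw [← real_inner_self_eq_norm_sq, ← hκ]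
      exact hM _
    have := hξ j (Finset.mem_range.1 hj)
    have := mul_le_mul this h3 (norm_nonneg _) zero_le_one
    linarith
  have h3 : noiseEnergy η φ xs ξ t ≤ (t * √M) ^ 2 :=
    (inner_postOp_self_le hη _ t _).trans (by gcongr)
  have h4 : noiseEnergy η φ xs ξ t / (2 * η ^ 4) ≤ (t * √M) ^ 2 / (2 * η ^ 4) := by gcongr
  linarith

lemma noiseEnergy_le_of_potential_le (hη : 0 < η) {xs : ℕ → X} {ξ : ℕ → ℝ} {t : ℕ} {c : ℝ}
    (hc : 0 < c) (h : potential η φ xs ξ t ≤ c) :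
    √(noiseEnergy η φ xs ξ t) / η ^ 2 ≤ √(2 * (halfLogDet η φ xs t + Real.log c)) := by
  have h1 := (Real.le_log_iff_exp_le hc).2 h
  have h2 : noiseEnergy η φ xs ξ t / (2 * η ^ 4) ≤ halfLogDet η φ xs t + Real.log c := by linarith
  have h3 : √(noiseEnergy η φ xs ξ t) / η ^ 2 = √(noiseEnergy η φ xs ξ t / η ^ 4) := by
    rw [Real.sqrt_div' _ (by positivity), show η ^ 4 = (η ^ 2) ^ 2 by ring,
      Real.sqrt_sq (by positivity)]
  rw [h3]
  refine Real.sqrt_le_sqrt ?_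
  calc noiseEnergy η φ xs ξ t / η ^ 4 = 2 * (noiseEnergy η φ xs ξ t / (2 * η ^ 4)) := by
        field_simp
    _ ≤ _ := by gcongr

variable [MeasurableSpace X] {Ω : Type*} [MeasurableSpace Ω]

/-- `H` carries no σ-algebra and `φ` is not assumed measurable, so measurability is propagated from
`κ` through the scalar update. Joint measurability in both points and `ω` allows the random query
points to be substituted. -/
theorem measurable_postCov (hκ : ∀ x y, κ x y = ⟪φ x, φ y⟫)
    (hκm : Measurable fun q : X × X => κ q.1 q.2) {xs : Ω → ℕ → X} {t : ℕ}
    (hx : ∀ j < t, Measurable fun ω => xs ω j) :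
    Measurable fun q : X × X × Ω => postCov η φ (xs q.2.2) t q.1 q.2.1 := by
  induction t with
  | zero =>
    simp only [postCov, postOp, ← hκ]
    exact hκm.comp (by fun_prop : Measurable fun q : X × X × Ω => (q.1, q.2.1))
  | succ t ih =>
    have ih := ih fun j hj => hx j (by omega)
    have hxt := hx t (by omega)
    have hrec : ∀ q : X × X × Ω, postCov η φ (xs q.2.2) (t + 1) q.1 q.2.1 =
        postCov η φ (xs q.2.2) t q.1 q.2.1 -
          postCov η φ (xs q.2.2) t (xs q.2.2 t) q.2.1
            / (η ^ 2 + postCov η φ (xs q.2.2) t (xs q.2.2 t) (xs q.2.2 t))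
            * postCov η φ (xs q.2.2) t q.1 (xs q.2.2 t) := by
      intro q
      simp only [postCov, postOp, inner_sub_right, inner_smul_right]
    simp_rw [hrec]
    have e1 := ih.comp (by fun_prop :
      Measurable fun q : X × X × Ω => (xs q.2.2 t, q.2.1, q.2.2))
    have e2 := ih.comp (by fun_prop :
      Measurable fun q : X × X × Ω => (xs q.2.2 t, xs q.2.2 t, q.2.2))
    have e3 := ih.comp (by fun_prop :
      Measurable fun q : X × X × Ω => (q.1, xs q.2.2 t, q.2.2))
    exact ih.sub ((e1.div (e2.const_add _)).mul e3)

theorem measurable_inner_postOp_noiseSum (hκ : ∀ x y, κ x y = ⟪φ x, φ y⟫)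
    (hκm : Measurable fun q : X × X => κ q.1 q.2) {xs : Ω → ℕ → X} {ξ : Ω → ℕ → ℝ} {t : ℕ}
    (hx : ∀ j < t, Measurable fun ω => xs ω j) (hξ : ∀ j < t, Measurable fun ω => ξ ω j) :
    Measurable fun q : X × Ω => ⟪φ q.1, postOp η (fun j => φ (xs q.2 j)) t
      (noiseSum φ (xs q.2) (ξ q.2) t)⟫ := by
  induction t with
  | zero =>
    simp only [noiseSum, Finset.range_zero, Finset.sum_empty, postOp, inner_zero_right]
    exact measurable_const
  | succ t ih =>
    have ih := ih (fun j hj => hx j (by omega)) fun j hj => hξ j (by omega)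
    have hxt := hx t (by omega)
    have hξt := hξ t (by omega)
    have hcov := measurable_postCov (η := η) hκ hκm (t := t) fun j hj => hx j (by omega)
    have hrec : ∀ q : X × Ω, ⟪φ q.1, postOp η (fun j => φ (xs q.2 j)) (t + 1)
          (noiseSum φ (xs q.2) (ξ q.2) (t + 1))⟫ =
        ⟪φ q.1, postOp η (fun j => φ (xs q.2 j)) t (noiseSum φ (xs q.2) (ξ q.2) t)⟫
          + ξ q.2 t * postCov η φ (xs q.2) t q.1 (xs q.2 t)
          - (⟪φ (xs q.2 t), postOp η (fun j => φ (xs q.2 j)) t (noiseSum φ (xs q.2) (ξ q.2) t)⟫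
            + ξ q.2 t * postCov η φ (xs q.2) t (xs q.2 t) (xs q.2 t))
            / (η ^ 2 + postCov η φ (xs q.2) t (xs q.2 t) (xs q.2 t))
            * postCov η φ (xs q.2) t q.1 (xs q.2 t) := by
      intro q
      have h2 : noiseSum φ (xs q.2) (ξ q.2) (t + 1)
          = noiseSum φ (xs q.2) (ξ q.2) t + ξ q.2 t • φ (xs q.2 t) := by
        rw [noiseSum, Finset.sum_range_succ, noiseSum]
      simp only [h2, postCov, postOp, postOp_add_smul, inner_sub_right, inner_smul_right,
        inner_add_right]
    simp_rw [hrec]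
    have e1 := ih.comp (by fun_prop : Measurable fun q : X × Ω => (xs q.2 t, q.2))
    have e2 := hcov.comp (by fun_prop : Measurable fun q : X × Ω => (xs q.2 t, xs q.2 t, q.2))
    have e3 := hcov.comp (by fun_prop : Measurable fun q : X × Ω => (q.1, xs q.2 t, q.2))
    have e4 : Measurable fun q : X × Ω => ξ q.2 t := hξt.comp measurable_snd
    exact (ih.add (e4.mul e3)).sub (((e1.add (e4.mul e2)).div (e2.const_add _)).mul e3)

theorem measurable_potential (hκ : ∀ x y, κ x y = ⟪φ x, φ y⟫)
    (hκm : Measurable fun q : X × X => κ q.1 q.2) {xs : Ω → ℕ → X} {ξ : Ω → ℕ → ℝ} {t : ℕ}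
    (hη : 0 < η)
    (hx : ∀ j < t, Measurable fun ω => xs ω j) (hξ : ∀ j < t, Measurable fun ω => ξ ω j) :
    Measurable fun ω => potential η φ (xs ω) (ξ ω) t := by
  induction t with
  | zero =>
    simp only [potential_zero]
    exact measurable_const
  | succ t ih =>
    have ih := ih (fun j hj => hx j (by omega)) fun j hj => hξ j (by omega)
    have hxt := hx t (by omega)
    have hξt := hξ t (by omega)
    have hcov := (measurable_postCov (η := η) hκ hκm (t := t) fun j hj => hx j (by omega)).comp
      (by fun_prop : Measurable fun ω : Ω => (xs ω t, xs ω t, ω))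
    have hmean := (measurable_inner_postOp_noiseSum (η := η) hκ hκm (t := t)
      (fun j hj => hx j (by omega)) fun j hj => hξ j (by omega)).comp
      (by fun_prop : Measurable fun ω : Ω => (xs ω t, ω))
    simp only [Function.comp_def] at hcov hmean
    simp_rw [potential_succ hη]
    fun_prop

end Potential

/-! ### Maximal inequality for supermartingales -/

section Ville

variable {Ω : Type*} {m : MeasurableSpace Ω} {P : Measure Ω} [IsFiniteMeasure P]

lemma mul_measureReal_le_setIntegral {M : Ω → ℝ} (hM : Integrable M P) {E : Set Ω}
    (hE : MeasurableSet E) {c : ℝ} (hc : ∀ ω ∈ E, c ≤ M ω) :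
    c * P.real E ≤ ∫ ω in E, M ω ∂P := by
  have h := setIntegral_mono_on (μ := P) (f := fun _ => c) (integrable_const c).integrableOn
    hM.integrableOn hE hc
  rw [setIntegral_const, smul_eq_mul, mul_comm] at h
  exact h

/-- Ville's maximal inequality. -/
theorem ville_inequality {ℱ : Filtration ℕ m} {M : ℕ → Ω → ℝ}
    (hm : ∀ t, Measurable[ℱ t] (M t)) (hint : ∀ t, Integrable (M t) P)
    (hstep : ∀ t A, MeasurableSet[ℱ t] A → ∫ ω in A, M (t + 1) ω ∂P ≤ ∫ ω in A, M t ω ∂P)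
    (c : ℝ) (n : ℕ) :
    c * P.real {ω | ∀ t ≤ n, M t ω ≤ c}ᶜ + ∫ ω in {ω | ∀ t ≤ n, M t ω ≤ c}, M n ω ∂P
      ≤ ∫ ω, M 0 ω ∂P := by
  have hG : ∀ n, MeasurableSet[ℱ n] {ω | ∀ t ≤ n, M t ω ≤ c} := by
    intro n
    rw [show {ω | ∀ t ≤ n, M t ω ≤ c} = ⋂ t, ⋂ (_ : t ≤ n), {ω | M t ω ≤ c} by ext; simp]
    refine MeasurableSet.iInter fun t => MeasurableSet.iInter fun ht => ?_
    exact ℱ.mono ht _ (hm t measurableSet_Iic)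
  induction n with
  | zero =>
    have h0 := (ℱ.le 0) _ (hG 0)
    rw [← integral_add_compl h0 (hint 0), add_comm]
    gcongr
    refine mul_measureReal_le_setIntegral (hint 0) h0.compl fun ω hω => ?_
    simp only [Set.mem_compl_iff, Set.mem_ofPred_eq, Nat.le_zero, forall_eq, not_le] at hω
    exact hω.le
  | succ n ih =>
    refine le_trans ?_ ih
    have hn := (ℱ.le n) _ (hG n)
    have hn1 := (ℱ.le (n + 1)) _ (hG (n + 1))
    have hsub : {ω | ∀ t ≤ n + 1, M t ω ≤ c} ⊆ {ω | ∀ t ≤ n, M t ω ≤ c} :=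
      fun ω h t ht => h t (by omega)
    set G := {ω | ∀ t ≤ n, M t ω ≤ c} with hGdef
    set G' := {ω | ∀ t ≤ n + 1, M t ω ≤ c} with hGdef'
    have hD : MeasurableSet (G \ G') := hn.diff hn1
    have h1 : P.real G'ᶜ = P.real Gᶜ + P.real (G \ G') := by
      rw [← measureReal_union _ hD]
      · congr 1
        ext ω
        have := @hsub ω
        simp only [Set.mem_compl_iff, Set.mem_union, Set.mem_sdiff]
        tauto
      · exact Set.disjoint_left.2 fun ω h h' => h h'.1
    -- `G \ G'` is the event of a first crossing at time `n + 1`; there the process exceeds `c` and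
    -- pays for the added probability.
    have h2 : ∫ ω in G, M (n + 1) ω ∂P
        = ∫ ω in G', M (n + 1) ω ∂P + ∫ ω in G \ G', M (n + 1) ω ∂P := by
      rw [← setIntegral_union Set.disjoint_sdiff_right hD (hint _).integrableOn
        (hint _).integrableOn, Set.union_sdiff_cancel hsub]
    have h3 : c * P.real (G \ G') ≤ ∫ ω in G \ G', M (n + 1) ω ∂P := by
      refine mul_measureReal_le_setIntegral (hint _) hD fun ω hω => ?_
      by_contra hlt
      refine hω.2 fun t ht => ?_
      rcases Nat.lt_or_ge t (n + 1) with h | h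
      · exact hω.1 t (by omega)
      · obtain rfl : t = n + 1 := by omega
        exact (not_le.1 hlt).le
    have h4 := hstep n G (hG n)
    rw [h1, mul_add]
    linarith

end Ville

/-! ### Comparisons as Bernoulli feedback, and the high-probability event -/

section Feedback

lemma integral_mul_eq_of_condExp_ae_eq {Ω : Type*} {𝒢 m : MeasurableSpace Ω} {P : Measure Ω}
    [IsFiniteMeasure P] (h𝒢 : 𝒢 ≤ m) {Z y w : Ω → ℝ} (hZ : Measurable[𝒢] Z) (hy : Integrable y P)
    (hZy : Integrable (fun ω => Z ω * y ω) P) (hw : P[y | 𝒢] =ᵐ[P] w) :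
    ∫ ω, Z ω * y ω ∂P = ∫ ω, Z ω * w ω ∂P := by
  rw [← integral_condExp h𝒢]
  refine integral_congr_ae ?_
  have h1 := condExp_mul_of_stronglyMeasurable_left (m := 𝒢) (μ := P) (f := Z)
      (g := y) hZ.stronglyMeasurable hZy hy
  refine h1.trans ?_
  filter_upwards [hw] with ω hω
  rw [Pi.mul_apply, hω]

variable {Ω X : Type*} {m : MeasurableSpace Ω} [MeasurableSpace X] {p : X → X → ℝ}
  {ρ : Measure X} {f : X → ℝ} {η : ℝ} {P : Measure Ω} {ℱ : Filtration ℕ m}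
  {τ : Ω → Trajectory X}

lemma measurable_borda [SFinite ρ] (hp : Measurable fun q : X × X => p q.1 q.2) :
    Measurable (borda p ρ) :=
  (hp.stronglyMeasurable.integral_prod_right (ν := ρ)).measurable

lemma borda_mem_Icc [IsProbabilityMeasure ρ] (hp : Measurable fun q : X × X => p q.1 q.2)
    (hp01 : ∀ x x', 0 ≤ p x x' ∧ p x x' ≤ 1) (x : X) : borda p ρ x ∈ Set.Icc 0 1 := by
  refine ⟨integral_nonneg fun x' => (hp01 x x').1, ?_⟩
  have hm : Measurable (p x) := hp.comp measurable_prodMk_left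
  have hi : Integrable (p x) ρ := Integrable.of_bound hm.aestronglyMeasurable 1
    (ae_of_all _ fun x' => by
      rw [Real.norm_eq_abs, abs_of_nonneg (hp01 x x').1]; exact (hp01 x x').2)
  refine (integral_mono hi (integrable_const 1) fun x' => (hp01 x x').2).trans ?_
  simp

variable [IsProbabilityMeasure P] [IsProbabilityMeasure ρ]

/-- Given the past, a comparison is won with the probability given by the Borda function. -/
theorem integral_mul_feedback (hfb : IsFeedbackProcess p ρ f η P ℱ τ)
    (hp : Measurable fun q : X × X => p q.1 q.2) (hp01 : ∀ x x', 0 ≤ p x x' ∧ p x x' ≤ 1)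
    (hcomp : ∀ ω t, (τ ω).q t = .comp) (t : ℕ) {Z : Ω → ℝ} (hZ : Measurable[ℱ t] Z)
    (hZi : Integrable Z P) :
    Integrable (fun ω => Z ω * (τ ω).y t) P ∧
    ∫ ω, Z ω * (τ ω).y t ∂P = ∫ ω, Z ω * borda p ρ ((τ ω).x t) ∂P := by
  have hx' : Measurable fun ω => (τ ω).x' t := (hfb.measurable_x' t).mono (ℱ.le _) le_rfl
  have hx : Measurable fun ω => (τ ω).x t := (hfb.measurable_x t).mono (ℱ.le _) le_rfl
  have hy : Measurable fun ω => (τ ω).y t := (hfb.measurable_y t).mono (ℱ.le _) le_rfl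
  have hZm : Measurable Z := hZ.mono (ℱ.le _) le_rfl
  have hyb : ∀ᵐ ω ∂P, ‖(τ ω).y t‖ ≤ 1 := by
    filter_upwards [hfb.comp_range t] with ω hω
    rcases hω (hcomp ω t) with h | h <;> simp [h]
  have hyi : Integrable (fun ω => (τ ω).y t) P := Integrable.of_bound hy.aestronglyMeasurable 1 hyb
  have hZy : Integrable (fun ω => Z ω * (τ ω).y t) P := hZi.mul_bdd hy.aestronglyMeasurable hyb
  refine ⟨hZy, ?_⟩
  have hpm : Measurable fun w : (ℝ × X) × X => w.1.1 * p w.1.2 w.2 :=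
    measurable_fst.fst.mul (hp.comp (by fun_prop : Measurable fun w : (ℝ × X) × X => (w.1.2, w.2)))
  have hW : Measurable fun ω => (Z ω, (τ ω).x t) := hZm.prodMk hx
  -- The opponent is independent of everything known at round `t`, so the joint law is a product and
  -- Fubini integrates `p` over `ρ` into the Borda function.
  have hindep : (fun ω => (Z ω, (τ ω).x t)) ⟂ᵢ[P] fun ω => (τ ω).x' t := by
    rw [IndepFun_iff_Indep]
    refine indep_of_indep_of_le_left (hfb.indep_x' t).symm ?_
    exact Measurable.comap_le (hZ.prodMk (hfb.measurable_x t))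
  have hmap := (indepFun_iff_map_prod_eq_prod_map_map hW.aemeasurable hx'.aemeasurable).1 hindep
  rw [hfb.map_x'] at hmap
  have hZp : Integrable (fun ω => Z ω * p ((τ ω).x t) ((τ ω).x' t)) P :=
    hZi.mul_bdd (c := 1)
      (hp.comp (hx.prodMk hx')).aestronglyMeasurable
      (ae_of_all _ fun ω => by
        rw [Real.norm_eq_abs, abs_of_nonneg (hp01 _ _).1]; exact (hp01 _ _).2)
  have : IsProbabilityMeasure (P.map fun ω => (Z ω, (τ ω).x t)) :=
    Measure.isProbabilityMeasure_map hW.aemeasurable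
  have hprod : Integrable (fun w : (ℝ × X) × X => w.1.1 * p w.1.2 w.2)
      ((P.map fun ω => (Z ω, (τ ω).x t)).prod ρ) := by
    rw [← hmap, integrable_map_measure hpm.aestronglyMeasurable (hW.prodMk hx').aemeasurable]
    exact hZp
  have hbm : Measurable fun w : ℝ × X => w.1 * borda p ρ w.2 :=
    measurable_fst.mul ((measurable_borda hp).comp measurable_snd)
  calc ∫ ω, Z ω * (τ ω).y t ∂P = ∫ ω, Z ω * p ((τ ω).x t) ((τ ω).x' t) ∂P := by
        refine integral_mul_eq_of_condExp_ae_eq (sup_le (ℱ.le t) hx'.comap_le)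
          (hZ.mono le_sup_left le_rfl) hyi hZy ((hfb.condExp_y t).trans (ae_of_all _ fun ω => ?_))
        simp only [hcomp]
    _ = ∫ w, w.1.1 * p w.1.2 w.2 ∂(P.map fun ω => ((Z ω, (τ ω).x t), (τ ω).x' t)) :=
        (integral_map (hW.prodMk hx').aemeasurable hpm.aestronglyMeasurable).symm
    _ = ∫ w, w.1 * borda p ρ w.2 ∂(P.map fun ω => (Z ω, (τ ω).x t)) := by
        rw [hmap, integral_prod _ hprod]
        simp only [integral_const_mul, borda]
    _ = _ := integral_map hW.aemeasurable hbm.aestronglyMeasurable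

variable {H : Type*} [NormedAddCommGroup H] [InnerProductSpace ℝ H] {κ : X → X → ℝ} {φ : X → H}

/-- The potential of the centered comparisons stays below `1 / δ` with probability `1 - δ`. -/
theorem measure_potential_gt_le (hfb : IsFeedbackProcess p ρ f η P ℱ τ)
    (hp : Measurable fun q : X × X => p q.1 q.2) (hp01 : ∀ x x', 0 ≤ p x x' ∧ p x x' ≤ 1)
    (hcomp : ∀ ω t, (τ ω).q t = .comp)
    (hκ : ∀ x y, κ x y = inner ℝ (φ x) (φ y)) (hκm : Measurable fun q : X × X => κ q.1 q.2)
    (hη : 1 / 2 ≤ η) {M : ℝ} (hM : ∀ x, κ x x ≤ M) {δ : ℝ} (hδ : 0 < δ) (n : ℕ) :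
    P {ω | ∀ t ≤ n, potential η φ (τ ω).x (fun j => (τ ω).y j - borda p ρ ((τ ω).x j)) t
      ≤ 1 / δ}ᶜ ≤ ENNReal.ofReal δ := by
  have hη0 : 0 < η := by linarith
  set ξ : Ω → ℕ → ℝ := fun ω j => (τ ω).y j - borda p ρ ((τ ω).x j) with hξ
  set b : ℕ → Ω → ℝ := fun t ω => borda p ρ ((τ ω).x t) with hb
  have hb01 : ∀ t ω, b t ω ∈ Set.Icc 0 1 := fun t ω => borda_mem_Icc hp hp01 _
  have hξb : ∀ᵐ ω ∂P, ∀ j, |ξ ω j| ≤ 1 := by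
    rw [ae_all_iff]
    intro j
    filter_upwards [hfb.comp_range j] with ω hω
    have h01 := hb01 j ω
    have : ξ ω j = (τ ω).y j - b j ω := rfl
    rw [this, abs_le]
    rcases hω (hcomp ω j) with h | h <;> rw [h] <;> constructor <;> linarith [h01.1, h01.2]
  have hxm : ∀ t, ∀ j ≤ t, Measurable[ℱ t] fun ω => (τ ω).x j := fun t j hj =>
    (hfb.measurable_x j).mono (ℱ.mono hj) le_rfl
  have hbm : ∀ t, Measurable[ℱ t] (b t) := fun t => (measurable_borda hp).comp (hxm t t le_rfl)
  have hξm : ∀ t, ∀ j < t, Measurable[ℱ t] fun ω => ξ ω j := fun t j hj =>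
    ((hfb.measurable_y j).mono (ℱ.mono hj) le_rfl).sub
      ((hbm j).mono (ℱ.mono hj.le) le_rfl)
  set D : ℕ → Ω → ℝ := fun t ω => potential η φ (τ ω).x (ξ ω) t with hD
  have hDm : ∀ t, Measurable[ℱ t] (D t) := fun t =>
    @measurable_potential _ _ _ _ _ _ _ _ Ω (ℱ t) hκ hκm (fun ω => (τ ω).x) ξ t hη0
      (fun j hj => hxm t j hj.le) (hξm t)
  have hbound : ∀ (t : ℕ) (Z : Ω → ℝ) (ζ : Ω → ℕ → ℝ), Measurable Z →
      (∀ ω, Z ω = potential η φ (τ ω).x (ζ ω) t) → (∀ᵐ ω ∂P, ∀ j, |ζ ω j| ≤ 1) →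
      Integrable Z P := by
    intro t Z ζ hZ hZζ hζ
    refine Integrable.of_bound hZ.aestronglyMeasurable
      (Real.exp ((t * √M) ^ 2 / (2 * η ^ 4))) ?_
    filter_upwards [hζ] with ω hω
    rw [hZζ, Real.norm_eq_abs, abs_of_pos (potential_pos _ _ _)]
    exact potential_le hκ hη0 hM _ fun j _ => hω j
  have hDi : ∀ t, Integrable (D t) P := fun t =>
    hbound t _ ξ ((hDm t).mono (ℱ.le t) le_rfl) (fun _ => rfl) hξb
  have hstep : ∀ t A, MeasurableSet[ℱ t] A →
      ∫ ω in A, D (t + 1) ω ∂P ≤ ∫ ω in A, D t ω ∂P := by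
    intro t A hA
    have hAm : MeasurableSet A := ℱ.le t _ hA
    have hbranch : ∀ c : Ω → ℝ, Measurable[ℱ t] c → (∀ ω, |c ω| ≤ 1) →
        Measurable[ℱ t] (A.indicator fun ω =>
          potential η φ (τ ω).x (Function.update (ξ ω) t (c ω)) (t + 1)) ∧
        Integrable (A.indicator fun ω =>
          potential η φ (τ ω).x (Function.update (ξ ω) t (c ω)) (t + 1)) P := by
      intro c hc hc1
      have hm1 : Measurable[ℱ t] fun ω =>
          potential η φ (τ ω).x (Function.update (ξ ω) t (c ω)) (t + 1) := by
        refine @measurable_potential _ _ _ _ _ _ _ _ Ω (ℱ t) hκ hκm (fun ω => (τ ω).x) _ (t + 1)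
          hη0 (fun j hj => hxm t j (by omega)) fun j hj => ?_
        by_cases hjt : j = t
        · subst hjt
          simpa using hc
        · simp only [Function.update_of_ne hjt]
          exact hξm t j (by omega)
      refine ⟨hm1.indicator hA, Integrable.indicator ?_ hAm⟩
      refine hbound (t + 1) _ (fun ω => Function.update (ξ ω) t (c ω))
        (hm1.mono (ℱ.le t) le_rfl) (fun _ => rfl) ?_
      filter_upwards [hξb] with ω hω j
      by_cases hjt : j = t
      · subst hjt
        simpa using hc1 ω
      · rw [Function.update_of_ne hjt]
        exact hω j
    obtain ⟨hZ1, hZ1i⟩ := hbranch (fun ω => 1 - b t ω)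
      ((hbm t).const_sub 1) fun ω => by
        rw [abs_le]; constructor <;> linarith [(hb01 t ω).1, (hb01 t ω).2]
    obtain ⟨hZ0, hZ0i⟩ := hbranch (fun ω => - b t ω) (hbm t).neg fun ω => by
        rw [abs_le]; constructor <;> linarith [(hb01 t ω).1, (hb01 t ω).2]
    set Z1 := A.indicator fun ω =>
      potential η φ (τ ω).x (Function.update (ξ ω) t (1 - b t ω)) (t + 1) with hZ1d
    set Z0 := A.indicator fun ω =>
      potential η φ (τ ω).x (Function.update (ξ ω) t (-b t ω)) (t + 1) with hZ0d
    obtain ⟨h1i, h1⟩ := integral_mul_feedback hfb hp hp01 hcomp t hZ1 hZ1i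
    obtain ⟨h0i, h0⟩ := integral_mul_feedback hfb hp hp01 hcomp t hZ0 hZ0i
    have hbmul : ∀ Z : Ω → ℝ, Integrable Z P → Integrable (fun ω => Z ω * b t ω) P := by
      intro Z hZ
      refine hZ.mul_bdd (c := 1) ((hbm t).mono (ℱ.le t) le_rfl).aestronglyMeasurable
        (ae_of_all _ fun ω => ?_)
      rw [Real.norm_eq_abs, abs_of_nonneg (hb01 t ω).1]
      exact (hb01 t ω).2
    have hupd : ∀ ω c, ξ ω t = c → Function.update (ξ ω) t c = ξ ω := by
      rintro ω c rfl
      exact Function.update_eq_self _ _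
    -- Since `y ∈ {0, 1}`, the next potential is `Z1 y + Z0 (1 - y)` with `Z1`, `Z0` known at round
    -- `t`. It is affine in `y`, so the conditional mean of `y` suffices.
    have hsplit : A.indicator (D (t + 1)) =ᵐ[P]
        fun ω => Z1 ω * (τ ω).y t + (Z0 ω - Z0 ω * (τ ω).y t) := by
      filter_upwards [hfb.comp_range t] with ω hω
      by_cases hωA : ω ∈ A
      · simp only [hZ1d, hZ0d, Set.indicator_of_mem hωA, hD]
        rcases hω (hcomp ω t) with h | h
        · rw [hupd ω (-b t ω) (by simp [hξ, hb, h]), h]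
          ring
        · rw [hupd ω (1 - b t ω) (by simp [hξ, hb, h]), h]
          ring
      · simp [hZ1d, hZ0d, Set.indicator_of_notMem hωA]
    have hbZ1 : Integrable (fun ω => Z1 ω * borda p ρ ((τ ω).x t)) P := hbmul _ hZ1i
    have hbZ0 : Integrable (fun ω => Z0 ω * borda p ρ ((τ ω).x t)) P := hbmul _ hZ0i
    have hd : Integrable (fun ω => Z0 ω - Z0 ω * (τ ω).y t) P := hZ0i.sub h0i
    have hbd : Integrable (fun ω => Z0 ω - Z0 ω * borda p ρ ((τ ω).x t)) P := hZ0i.sub hbZ0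
    rw [← integral_indicator hAm, ← integral_indicator hAm, integral_congr_ae hsplit,
      integral_add h1i hd, integral_sub hZ0i h0i, h1, h0,
      ← integral_sub hZ0i hbZ0, ← integral_add hbZ1 hbd]
    refine integral_mono (hbZ1.add hbd) ((hDi t).indicator hAm) fun ω => ?_
    by_cases hωA : ω ∈ A
    · simp only [hZ1d, hZ0d, Set.indicator_of_mem hωA, hD]
      have h := potential_step (φ := φ) hη (τ ω).x (ξ ω) t (hb01 t ω).1 (hb01 t ω).2
      have hbd : borda p ρ ((τ ω).x t) = b t ω := rfl
      simp only [hbd]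
      linarith
    · simp [hZ1d, hZ0d, Set.indicator_of_notMem hωA]
  have hv := ville_inequality hDm hDi hstep (1 / δ) n
  have hD0 : ∫ ω, D 0 ω ∂P = 1 := by simp [hD, potential_zero]
  have hnn : 0 ≤ ∫ ω in {ω | ∀ t ≤ n, D t ω ≤ 1 / δ}, D n ω ∂P :=
    integral_nonneg fun ω => (potential_pos _ _ _).le
  have hfin : P.real {ω | ∀ t ≤ n, D t ω ≤ 1 / δ}ᶜ ≤ δ := by
    have h2 : 1 / δ * P.real {ω | ∀ t ≤ n, D t ω ≤ 1 / δ}ᶜ ≤ 1 := by linarith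
    rwa [one_div_mul_eq_div, div_le_one hδ] at h2
  rw [← ofReal_measureReal]
  exact ENNReal.ofReal_le_ofReal hfin

end Feedback

/-! ### Deterministic analysis of a run -/

namespace Trajectory

variable {X : Type*} {par : Params X} {τ : Trajectory X}

/-- With `γ = 0`, only comparisons are made. -/
theorem IsCompGPUCB.q_eq_comp (h : τ.IsCompGPUCB par) (hγ : par.γ = 0)
    (hβ : ∀ t, 0 ≤ par.betaR t) (t : ℕ) : τ.q t = .comp := by
  classical
  by_cases hs : ∀ s < t, ¬ τ.Stops par s
  · exact (h.phase1 t hs).1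
  · push Not at hs
    have hex : ∃ s, τ.Stops par s := ⟨hs.choose, hs.choose_spec.2⟩
    have hlt : Nat.find hex < t := (Nat.find_min' hex hs.choose_spec.2).trans_lt hs.choose_spec.1
    refine ((h.phase2 (Nat.find hex) t hlt (fun s hs => Nat.find_min hex hs)
      (Nat.find_spec hex)).2.2).2 ?_
    rw [hγ]
    exact mul_nonneg (hβ t) (Real.sqrt_nonneg _)

lemma before_comp (h : ∀ t, τ.q t = .comp) (t : ℕ) : τ.before .comp t = Finset.range t := by
  simp [before, h]

/-- On the event that the confidence bounds hold, one of the first `N` queried points has a gap of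
at most the average of the confidence widths. -/
theorem IsCompGPUCB.exists_gap_le [Nonempty X] (h : τ.IsCompGPUCB par) (hγ : par.γ = 0)
    {F : X → ℝ} {N : ℕ} (hN : 0 < N)
    (hβ : ∀ t, 0 ≤ par.betaR t)
    (hconf : ∀ t < N, ∀ x, |τ.mean par .comp t x - F x| ≤ par.betaR t * τ.sd par .comp t x) :
    ∃ t < N, (⨆ z, F z) - F (τ.x t) ≤
      (∑ s ∈ Finset.range N, 2 * (par.betaR s * τ.sd par .comp s (τ.x s))) / N := by
  classical
  have hgap : ∀ t < N, (∀ s < t, ¬ τ.Stops par s) →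
      (⨆ z, F z) - F (τ.x t) ≤ 2 * (par.betaR t * τ.sd par .comp t (τ.x t)) := by
    intro t ht hs
    have hmax := (h.phase1 t hs).2
    rw [sub_le_iff_le_add]
    refine ciSup_le fun x => ?_
    have h1 := abs_le.1 (hconf t ht x)
    have h2 := abs_le.1 (hconf t ht (τ.x t))
    have h3 := hmax x
    rw [ucbR, ucbR] at h3
    linarith
  have hN' : (0 : ℝ) < N := by exact_mod_cast hN
  have hnn : ∀ s, 0 ≤ 2 * (par.betaR s * τ.sd par .comp s (τ.x s)) := fun s =>
    mul_nonneg zero_le_two (mul_nonneg (hβ s) (Real.sqrt_nonneg _))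
  -- The gap bound still covers the first stopping round itself, whose width is at most `γ = 0`; its
  -- gap is then at most `0`. Without a stop, not every gap can exceed the average.
  by_cases hs : ∃ s, s < N ∧ τ.Stops par s
  · have hspec := Nat.find_spec hs
    refine ⟨Nat.find hs, hspec.1, ?_⟩
    have h1 := hgap _ hspec.1 fun s hs' hst =>
      Nat.find_min hs hs' ⟨hs'.trans hspec.1, hst⟩
    have h2 := hspec.2
    rw [Stops, hγ] at h2
    have h3 : 0 ≤ (∑ s ∈ Finset.range N, 2 * (par.betaR s * τ.sd par .comp s (τ.x s))) / N :=
      div_nonneg (Finset.sum_nonneg fun s _ => hnn s) hN'.le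
    linarith
  · push Not at hs
    by_contra! hcon
    have h1 : ∑ _t ∈ Finset.range N,
        (∑ s ∈ Finset.range N, 2 * (par.betaR s * τ.sd par .comp s (τ.x s))) / N
        < ∑ t ∈ Finset.range N, 2 * (par.betaR t * τ.sd par .comp t (τ.x t)) := by
      refine Finset.sum_lt_sum_of_nonempty (Finset.nonempty_range_iff.2 hN.ne') fun t ht => ?_
      have ht := Finset.mem_range.1 ht
      exact (hcon t ht).trans_le (hgap t ht fun s hst => hs s (hst.trans ht))
    rw [Finset.sum_const, Finset.card_range, nsmul_eq_mul, mul_div_cancel₀ _ hN'.ne'] at h1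
    exact lt_irrefl _ h1

/-- With comparisons only, the round `t < ⌊Lam / lamC⌋` is within the budget. -/
lemma mem_roundsWithin (h : ∀ t, τ.q t = .comp) {lamL lamC Lam : ℝ} (hC : 0 < lamC) {t : ℕ}
    (ht : t < ⌊Lam / lamC⌋₊) : t ∈ τ.roundsWithin lamL lamC Lam := by
  have h1 : ((t + 1 : ℕ) : ℝ) ≤ Lam / lamC := by
    refine (Nat.cast_le.2 (Nat.succ_le_of_lt ht)).trans (Nat.floor_le ?_)
    by_contra hneg
    rw [Nat.floor_of_nonpos (not_le.1 hneg).le] at ht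
    omega
  rw [le_div_iff₀ hC] at h1
  simpa [roundsWithin, cost, h] using h1

/-- The opponent's gap can only lower the minimum. Boundedness of `f` makes all gaps nonnegative, so
the real infimum is genuine. -/
lemma simpleRegret_le (h : ∀ t, τ.q t = .comp) {f : X → ℝ} (hf : BddAbove (Set.range f))
    {lamL lamC Lam : ℝ} (hC : 0 < lamC) {t : ℕ} (ht : t < ⌊Lam / lamC⌋₊) :
    τ.simpleRegret f lamL lamC Lam ≤ (⨆ z, f z) - f (τ.x t) := by
  have hbdd : BddBelow (τ.roundRegret f '' τ.roundsWithin lamL lamC Lam) := by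
    refine ⟨0, ?_⟩
    rintro _ ⟨s, -, rfl⟩
    simp only [roundRegret, h]
    exact le_min (sub_nonneg.2 (le_ciSup hf _)) (sub_nonneg.2 (le_ciSup hf _))
  refine (csInf_le hbdd (Set.mem_image_of_mem _ (mem_roundsWithin h hC ht))).trans ?_
  simp only [roundRegret, h]
  exact min_le_left _ _

end Trajectory

/-! ### Reproducing kernel, sum of the widths and conclusion -/

lemma rkhsKernel_eq_inner {X : Type*} (H : Type*) [NormedAddCommGroup H] [InnerProductSpace ℝ H]
    [CompleteSpace H] [RKHS ℝ H X ℝ] (x y : X) :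
    rkhsKernel H x y = inner ℝ (RKHS.kerFun H x 1) (RKHS.kerFun H y 1) := by
  rw [RKHS.kerFun_inner, RKHS.kerFun_apply, rkhsKernel]
  simp

lemma inner_kerFun_one {X : Type*} {H : Type*} [NormedAddCommGroup H] [InnerProductSpace ℝ H]
    [CompleteSpace H] [RKHS ℝ H X ℝ] (g : H) (x : X) :
    inner ℝ g (RKHS.kerFun H x (1 : ℝ)) = g x := by
  rw [RKHS.inner_kerFun]
  simp

/-- `(∑ σ)² ≤ N ∑ σ²`, and the sum of squares is bounded by the information gain. -/
lemma sum_mul_postSD_le {X : Type*} [Nonempty X] {H : Type*} [NormedAddCommGroup H]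
    [InnerProductSpace ℝ H] {κ : X → X → ℝ} {φ : X → H}
    (hκ : ∀ x y, κ x y = inner ℝ (φ x) (φ y)) {η : ℝ} (hη : 0 < η) {M : ℝ} (hM : ∀ x, κ x x ≤ M)
    {β : ℕ → ℝ} {b : ℝ} {N : ℕ} (hN : 0 < N) (hb : 0 ≤ b) (hβ : ∀ t < N, β t ≤ b) (xs : ℕ → X) :
    (∑ s ∈ Finset.range N, 2 * (β s * postSD κ η (Finset.range s) xs (xs s))) / N ≤
      2 * b * √(2 * (η ^ 2 + M) * maxInfoGain κ η N / N) := by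
  have hN' : (0 : ℝ) < N := by exact_mod_cast hN
  set σ : ℕ → ℝ := fun s => postSD κ η (Finset.range s) xs (xs s) with hσ
  have hσ0 : ∀ s, 0 ≤ σ s := fun s => Real.sqrt_nonneg _
  have h1 : ∑ s ∈ Finset.range N, 2 * (β s * σ s) ≤ 2 * b * ∑ s ∈ Finset.range N, σ s := by
    rw [Finset.mul_sum]
    refine Finset.sum_le_sum fun s hs => ?_
    have := mul_le_mul_of_nonneg_right (hβ s (Finset.mem_range.1 hs)) (hσ0 s)
    linarith
  have h2 : ∑ s ∈ Finset.range N, σ s ^ 2 ≤ 2 * (η ^ 2 + M) * maxInfoGain κ η N := by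
    refine le_trans (le_of_eq (Finset.sum_congr rfl fun s _ => ?_)) (sum_postCov_le hκ hη hM xs N)
    rw [hσ]
    simp only [postSD]
    rw [postVar_range hκ hη, Real.sq_sqrt (postCov_self_nonneg hη _ _ _)]
  have h3 : (∑ s ∈ Finset.range N, σ s) / N ≤ √(2 * (η ^ 2 + M) * maxInfoGain κ η N / N) := by
    refine Real.le_sqrt_of_sq_le ?_
    have h4 := sq_sum_le_card_mul_sum_sq (s := Finset.range N) (f := σ)
    rw [Finset.card_range] at h4
    rw [div_pow, div_le_div_iff₀ (by positivity) hN']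
    calc (∑ s ∈ Finset.range N, σ s) ^ 2 * N ≤ (N * ∑ s ∈ Finset.range N, σ s ^ 2) * N := by gcongr
      _ ≤ (N * (2 * (η ^ 2 + M) * maxInfoGain κ η N)) * N := by gcongr
      _ = _ := by ring
  calc _ ≤ (2 * b * ∑ s ∈ Finset.range N, σ s) / N := by gcongr
    _ = 2 * b * ((∑ s ∈ Finset.range N, σ s) / N) := by ring
    _ ≤ _ := by gcongr

/-- The confidence multiplier is dominated by `B + √(Φ + log (1 / δ))` as soon as the information
gain `Φ` is bounded away from `0`. -/
lemma multiplier_le {B Φ ℓ g : ℝ} (hB : 0 ≤ B) (hℓ : 0 ≤ ℓ) (hg : 0 < g) (hgΦ : g ≤ Φ) :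
    2 * B + √(2 * (Φ + 1 + ℓ)) ≤ (2 + √(2 + 2 / g)) * (B + √(Φ + ℓ)) := by
  have h1 : √(2 * (Φ + 1 + ℓ)) ≤ √(2 + 2 / g) * √(Φ + ℓ) := by
    rw [← Real.sqrt_mul (by positivity)]
    refine Real.sqrt_le_sqrt ?_
    have h2 : 1 ≤ (Φ + ℓ) / g := by rw [one_le_div hg]; linarith
    have h3 : (2 + 2 / g) * (Φ + ℓ) = 2 * (Φ + ℓ) + 2 * ((Φ + ℓ) / g) := by ring
    linarith
  have h4 : 0 ≤ √(2 + 2 / g) * B := by positivity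
  have h5 : 0 ≤ √(Φ + ℓ) := Real.sqrt_nonneg _
  linarith

end DuelingChoice

theorem theorem1 {d : ℕ} (r : ℝ) (𝒳 : Set (EuclideanSpace ℝ (Fin d)))
    (h𝒳 : ∀ x ∈ 𝒳, ∀ i, 0 ≤ x i ∧ x i ≤ r)
    -- the RKHS and its kernel `κ`, measurable and bounded on the diagonal
    (H : Type*) [NormedAddCommGroup H] [InnerProductSpace ℝ H] [CompleteSpace H] [RKHS ℝ H 𝒳 ℝ]
    (κ : 𝒳 → 𝒳 → ℝ) (hκ : κ = DuelingChoice.rkhsKernel H)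
    (hκ_meas : Measurable fun q : 𝒳 × 𝒳 => κ q.1 q.2)
    (hκ_bdd : ∃ M : ℝ, ∀ x, κ x x ≤ M)
    (η : ℝ) (hη : 1 / 2 ≤ η) (L₁ : ℝ) (hL₁ : 0 < L₁) :
    ∃ C : ℝ, 0 < C ∧
      ∀ (B : ℝ) (δ : ℝ) (_ : 0 < δ) (_ : δ < 1)
        -- the target function and the comparisons
        (f : H) (_ : ‖f‖ ≤ B)
        (p : 𝒳 → 𝒳 → ℝ) (_ : Measurable fun q : 𝒳 × 𝒳 => p q.1 q.2)
        (_ : ∀ x x', 0 ≤ p x x' ∧ p x x' ≤ 1)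
        (ρ : Measure 𝒳) (_ : IsProbabilityMeasure ρ)
        (_ : ∃ g : H, (∀ x, g x = DuelingChoice.borda p ρ x) ∧ ‖g‖ ≤ B)
        (fc : 𝒳 → ℝ) (_ : ∀ x, fc x = f x)
        (L₂ : ℝ) (_ : 0 < L₂)
        (_ : DuelingChoice.BordaSandwich L₁ L₂ fc (DuelingChoice.borda p ρ))
        -- costs and budget
        (lamL lamC Lam : ℝ) (_ : 0 < lamC) (_ : lamC < lamL) (_ : lamC ≤ Lam)
        -- a run of the algorithm with `ζ = γ = 0`
        (beta : ℕ → ℝ)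
        (Ω : Type*) (m : MeasurableSpace Ω) (P : Measure Ω) (_ : IsProbabilityMeasure P)
        (ℱ : Filtration ℕ m) (τ : Ω → DuelingChoice.Trajectory 𝒳)
        (_ : DuelingChoice.IsFeedbackProcess p ρ f η P ℱ τ)
        (_ : ∀ ω, (τ ω).IsCompGPUCB
          { κ := κ
            η := η
            betaR := fun t =>
              2 * B + √(2 * (DuelingChoice.maxInfoGain κ η t + 1 + Real.log (1 / δ)))
            beta := beta
            L₂ := L₂
            ζ := 0
            γ := 0 }),
        -- only comparisons are made
        (∀ ω t, (τ ω).q t = .comp) ∧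
        -- the bound fails with probability at most `δ`
        P {ω | ¬ (τ ω).simpleRegret f lamL lamC Lam ≤
            C * (B + √(DuelingChoice.maxInfoGain κ η ⌈Lam / lamC⌉₊ + Real.log (1 / δ))) *
              √(DuelingChoice.maxInfoGain κ η ⌈Lam / lamC⌉₊ / (⌈Lam / lamC⌉₊ : ℝ))} ≤
          ENNReal.ofReal δ := by
  classical
  obtain ⟨M₀, hM₀⟩ := hκ_bdd
  set M := max M₀ 0 with hMdef
  have hM : ∀ x, κ x x ≤ M := fun x => (hM₀ x).trans (le_max_left _ _)
  have hM0 : 0 ≤ M := le_max_right _ _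
  have hη0 : 0 < η := by linarith
  set φ : 𝒳 → H := fun x => RKHS.kerFun H x (1 : ℝ) with hφ
  have hκφ : ∀ x y, κ x y = inner ℝ (φ x) (φ y) := fun x y => by
    rw [hκ, DuelingChoice.rkhsKernel_eq_inner]
  set Φ := DuelingChoice.maxInfoGain κ η with hΦ
  -- `L₁` is from the sandwich, `2` from gap versus width, the next factor from `multiplier_le` with
  -- `g = Φ 1`. The `4` is the `2` of the variance sum, doubled by passing from floor to ceiling. If
  -- `Φ 1 = 0`, the quotient is `0` and `C` is still positive.
  refine ⟨L₁ * (2 * (2 + √(2 + 2 / Φ 1)) * √(4 * (η ^ 2 + M))), by positivity, ?_⟩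
  intro B δ hδ0 hδ1 f hf p hp hp01 ρ hρ hg fc hfc L₂ hL₂ hsand lamL lamC Lam hC hCL hLam beta Ω m P
    hP ℱ τ hfb halg
  obtain ⟨ω₀⟩ : Nonempty Ω := nonempty_of_isProbabilityMeasure P
  have hne : Nonempty 𝒳 := ⟨(τ ω₀).x 0⟩
  have hB : 0 ≤ B := (norm_nonneg _).trans hf
  have hℓ : 0 ≤ Real.log (1 / δ) := Real.log_nonneg (by rw [one_le_div hδ0]; exact hδ1.le)
  have hΦ0 : ∀ n, 0 ≤ Φ n := DuelingChoice.maxInfoGain_nonneg hκφ hη0 hM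
  have hΦm : Monotone Φ := DuelingChoice.maxInfoGain_mono hκφ hη0 hM
  have hcomp : ∀ ω t, (τ ω).q t = .comp := fun ω => (halg ω).q_eq_comp rfl fun t => by positivity
  refine ⟨hcomp, ?_⟩
  obtain ⟨g, hg, hgB⟩ := hg
  have hgφ : ∀ x, inner ℝ g (φ x) = DuelingChoice.borda p ρ x := fun x => by
    rw [hφ, DuelingChoice.inner_kerFun_one, hg]
  have hfbdd : BddAbove (Set.range f) := by
    refine ⟨‖f‖ * √M, ?_⟩
    rintro _ ⟨x, rfl⟩
    rw [← DuelingChoice.inner_kerFun_one]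
    refine (real_inner_le_norm _ _).trans ?_
    gcongr
    refine Real.le_sqrt_of_sq_le ?_
    rw [← real_inner_self_eq_norm_sq, ← hκφ]
    exact hM x
  set N := ⌊Lam / lamC⌋₊ with hN
  set N' := ⌈Lam / lamC⌉₊ with hN'
  have hN1 : 1 ≤ N := Nat.le_floor (by rw [Nat.cast_one, one_le_div hC]; exact hLam)
  have hNN' : N ≤ N' := Nat.floor_le_ceil _
  -- Only `N` comparisons are affordable, while the bound is stated with `N'`; `Λ ≥ λ_c` gives `N ≥
  -- 1`, so this costs a factor of `2`.
  have hN'N : N' ≤ 2 * N := (Nat.ceil_le_floor_add_one _).trans (by omega)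
  refine le_trans (measure_mono ?_) (DuelingChoice.measure_potential_gt_le hfb hp hp01 hcomp hκφ
    hκ_meas hη hM hδ0 N)
  rw [Set.subset_compl_comm]
  intro ω hω
  simp only [Set.mem_compl_iff, Set.mem_ofPred_eq, not_not] at hω ⊢
  set b := 2 * B + √(2 * (Φ N' + 1 + Real.log (1 / δ))) with hb
  have hconf : ∀ t < N, ∀ x, |DuelingChoice.postMean κ η (Finset.range t) (τ ω).x (τ ω).y x
      - DuelingChoice.borda p ρ x| ≤ (2 * B + √(2 * (Φ t + 1 + Real.log (1 / δ))))
        * DuelingChoice.postSD κ η (Finset.range t) (τ ω).x x := by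
    intro t ht x
    have h1 := DuelingChoice.abs_postMean_sub_le hκφ hη0 g (τ ω).x (τ ω).y t x
    simp only [hgφ] at h1
    refine h1.trans (mul_le_mul_of_nonneg_right ?_ (Real.sqrt_nonneg _))
    have h2 := DuelingChoice.noiseEnergy_le_of_potential_le hη0 (by positivity) (hω t ht.le)
    -- The multiplier has slack: `B` in place of `2 * B`, and no summand `1`, would suffice here.
    have h3 := DuelingChoice.halfLogDet_le_maxInfoGain hκφ hη0 hM (τ ω).x t
    have h4 : √(2 * (DuelingChoice.halfLogDet η φ (τ ω).x t + Real.log (1 / δ))) ≤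
        √(2 * (Φ t + 1 + Real.log (1 / δ))) := Real.sqrt_le_sqrt (by linarith)
    linarith
  obtain ⟨t, htN, ht⟩ := (halg ω).exists_gap_le rfl (F := DuelingChoice.borda p ρ) (N := N)
    (by omega) (fun t => by positivity) (by
      intro t ht x
      simp only [DuelingChoice.Trajectory.mean, DuelingChoice.Trajectory.sd,
        DuelingChoice.Trajectory.before_comp (hcomp ω)]
      exact hconf t ht x)
  simp only [DuelingChoice.Trajectory.sd, DuelingChoice.Trajectory.before_comp (hcomp ω)] at ht
  have hbt : ∀ t < N, 2 * B + √(2 * (Φ t + 1 + Real.log (1 / δ))) ≤ b := by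
    intro t ht
    have := hΦm (show t ≤ N' by omega)
    have h4 : √(2 * (Φ t + 1 + Real.log (1 / δ))) ≤ √(2 * (Φ N' + 1 + Real.log (1 / δ))) :=
      Real.sqrt_le_sqrt (by linarith)
    linarith
  have hgap := ht.trans (DuelingChoice.sum_mul_postSD_le hκφ hη0 hM (by omega) (by positivity)
    hbt (τ ω).x)
  have hreg : (τ ω).simpleRegret f lamL lamC Lam ≤
      L₁ * (2 * b * √(2 * (η ^ 2 + M) * Φ N / N)) := by
    refine (DuelingChoice.Trajectory.simpleRegret_le (hcomp ω) hfbdd hC htN).trans ?_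
    have h1 := (hsand ((τ ω).x t)).1
    simp only [hfc] at h1
    rw [one_div, inv_mul_le_iff₀ hL₁] at h1
    exact h1.trans (by gcongr)
  refine hreg.trans ?_
  have hNr : (0 : ℝ) < N := by exact_mod_cast hN1
  have hN'r : (0 : ℝ) < N' := by exact_mod_cast hN1.trans hNN'
  have hwidth : √(2 * (η ^ 2 + M) * Φ N / N) ≤ √(4 * (η ^ 2 + M)) * √(Φ N' / N') := by
    rw [← Real.sqrt_mul (by positivity)]
    refine Real.sqrt_le_sqrt ?_
    rw [mul_div_assoc', div_le_div_iff₀ hNr hN'r]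
    have h1 : (N' : ℝ) ≤ 2 * N := by exact_mod_cast hN'N
    have h2 := hΦm hNN'
    have h3 := hΦ0 N
    have h4 := hΦ0 N'
    calc 2 * (η ^ 2 + M) * Φ N * N' ≤ 2 * (η ^ 2 + M) * Φ N' * (2 * N) := by gcongr
      _ = _ := by ring
  -- For a kernel vanishing on the diagonal, `Φ` is `0` and the `1` in the multiplier cannot be
  -- absorbed, but then the width factor is `0`.
  by_cases hdeg : ∀ x, κ x x ≤ 0
  · have hΦN : Φ N ≤ 0 := by
      refine ciSup_le fun x => ?_
      obtain ⟨xs, rfl⟩ := DuelingChoice.exists_extension x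
      rw [DuelingChoice.infoGain_eq_halfLogDet hκφ hη0]
      exact (DuelingChoice.halfLogDet_le hκφ hη0 hdeg xs N).trans (by simp)
    have hz : Φ N = 0 := le_antisymm hΦN (hΦ0 N)
    rw [hz]
    simp only [mul_zero, zero_div, Real.sqrt_zero]
    positivity
  · push Not at hdeg
    obtain ⟨x, hx⟩ := hdeg
    have hmult := DuelingChoice.multiplier_le hB hℓ
      (DuelingChoice.maxInfoGain_one_pos hκφ hη0 hM hx) (hΦm (hN1.trans hNN'))
    calc L₁ * (2 * b * √(2 * (η ^ 2 + M) * Φ N / N))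
        ≤ L₁ * (2 * ((2 + √(2 + 2 / Φ 1)) * (B + √(Φ N' + Real.log (1 / δ)))) *
          (√(4 * (η ^ 2 + M)) * √(Φ N' / N'))) := by gcongr
      _ = _ := by ring
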